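/- For real $\nu,x\ge 0$ let $$I_\nu(x)=\sum_{k=0}^{\infty}\frac{1}{k!\,\Gamma(k+\nu+1)}\Bigl(\frac x2\Bigr)^{2k+\nu},\qquad H(\nu,x)=\sum_{k=1}^{\infty}\frac{I_{\nu+k}(x)}{I_\nu(x)},\qquad F(\nu,x)=\frac{x}{\nu+\sqrt{\nu^2+x^2}},$$ where for $x=0<\nu$ the ratios $I_{\nu+k}(x)/I_\nu(x)$ are given their limiting value $0$. Let $\alpha_0=-\log(\sqrt2-1)$, let $[x]$ denote the floor of $x$, and write $\nu_f=\nu-[\nu]$. Then: 1. For all $\nu,x\ge 0$ the series $H(\nu,x)$ converges and $$F(\nu+1,x)\,\bigl(1+F(\nu+2,x)\bigr)\le H(\nu,x)\le \frac{F(\nu+\frac12,x)}{1-F(\nu+\frac32,x)}.$$ 2. If $\nu,x\ge 0$ and $[\nu]+2\le[x]$, then $\mathcal L(\nu,x)\le H(\nu,x)\le\mathcal U(\nu,x)$, where $$\begin{aligned}\mathcal L(\nu,x)={}&\frac{2x\,e^{-\frac1x(\nu+1)}}{\nu+\frac32+\sqrt{(\nu+\frac32)^2+4x}}-\frac{2x\,e^{-\frac1{2x}([x]-\nu-\nu_f+1)([x]+\nu-\nu_f+2)}}{[x]+\frac32+\sqrt{([x]+\frac32)^2+\frac{8x}{\pi}}}\\&+e^{-\frac{([x]-[\nu]-1)([x]+\nu+\nu_f)}{2x}}\,F([x]+\nu_f,x)\,\bigl(1+F([x]+\nu_f+1,x)\bigr),\end{aligned}$$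 $$\begin{aligned}\mathcal U(\nu,x)={}&\frac{2x}{\alpha_0}\left[\frac{1}{\nu+\sqrt{\nu^2+\frac{8x}{\pi\alpha_0}}}-\frac{e^{-\frac{\alpha_0}{2x}(x^2-\nu^2)}}{x+\sqrt{x^2+\frac{4x}{\alpha_0}}}\right]\\&+e^{-\frac{\alpha_0}{2x}([x]-[\nu]-1)([x]+\nu+\nu_f-1)}\,\frac{F([x]+\nu_f-\frac12,x)}{1-F([x]+\nu_f+\frac12,x)}.\end{aligned}$$ 3. Both bounds in part 2 scale like $\sqrt x$: for every fixed $\nu\ge 0$, as $x\to\infty$, $$\frac{\mathcal L(\nu,x)}{\sqrt x}\to 1,\qquad \frac{\mathcal U(\nu,x)}{\sqrt x}\to\sqrt{\frac{\pi}{2\alpha_0}}.$$ -/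

import Mathlib

open Filter Topology

noncomputable section

/-- The modified Bessel function of the first kind `I_ν(x)`, for real order `ν` and real `x ≥ 0`:
`∑_{k ≥ 0} (x/2)^(2k+ν) / (k! Γ(k+ν+1))`. -/
def besselI (ν x : ℝ) : ℝ :=
  ∑' k : ℕ, 1 / ((k.factorial : ℝ) * Real.Gamma ((k : ℝ) + ν + 1)) * (x / 2) ^ (2 * (k : ℝ) + ν)

/-- The `k`-th term (`k = 0, 1, 2, …`) of the series `H(ν,x)`, namely `I_{ν+(k+1)}(x) / I_ν(x)`.
For `x = 0 < ν`, where both Bessel values vanish, this is `0`, the limit of the ratio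
as `x ↓ 0`. -/
def besselHTerm (ν x : ℝ) (k : ℕ) : ℝ :=
  besselI (ν + ((k : ℝ) + 1)) x / besselI ν x

/-- `H(ν,x) = ∑_{k ≥ 1} I_{ν+k}(x) / I_ν(x)`. -/
def besselH (ν x : ℝ) : ℝ :=
  ∑' k : ℕ, besselHTerm ν x k

/-- `F(ν,x) = x / (ν + √(ν² + x²))`. -/
def besselF (ν x : ℝ) : ℝ :=
  x / (ν + √(ν ^ 2 + x ^ 2))

/-- `α₀ = -log(√2 - 1)`. -/
def besselAlpha : ℝ :=
  -Real.log (√2 - 1)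

/-- The lower bound `𝓛(ν,x)`; here `[x] = ⌊x⌋` and `ν_f = ν - [ν]` is the fractional part. -/
def besselLower (ν x : ℝ) : ℝ :=
  2 * x * Real.exp (-(1 / x) * (ν + 1)) / (ν + 3 / 2 + √((ν + 3 / 2) ^ 2 + 4 * x))
  - 2 * x * Real.exp (-(1 / (2 * x)) * ((⌊x⌋ : ℝ) - ν - Int.fract ν + 1)
        * ((⌊x⌋ : ℝ) + ν - Int.fract ν + 2))
      / ((⌊x⌋ : ℝ) + 3 / 2 + √(((⌊x⌋ : ℝ) + 3 / 2) ^ 2 + 8 * x / Real.pi))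
  + Real.exp (-(((⌊x⌋ : ℝ) - (⌊ν⌋ : ℝ) - 1) * ((⌊x⌋ : ℝ) + ν + Int.fract ν) / (2 * x)))
      * besselF ((⌊x⌋ : ℝ) + Int.fract ν) x * (1 + besselF ((⌊x⌋ : ℝ) + Int.fract ν + 1) x)

/-- The upper bound `𝓤(ν,x)`. -/
def besselUpper (ν x : ℝ) : ℝ :=
  2 * x / besselAlpha
    * (1 / (ν + √(ν ^ 2 + 8 * x / (Real.pi * besselAlpha)))
      - Real.exp (-(besselAlpha / (2 * x)) * (x ^ 2 - ν ^ 2)) / (x + √(x ^ 2 + 4 * x / besselAlpha)))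
  + Real.exp (-(besselAlpha / (2 * x)) * ((⌊x⌋ : ℝ) - (⌊ν⌋ : ℝ) - 1)
        * ((⌊x⌋ : ℝ) + ν + Int.fract ν - 1))
      * (besselF ((⌊x⌋ : ℝ) + Int.fract ν - 1 / 2) x
          / (1 - besselF ((⌊x⌋ : ℝ) + Int.fract ν + 1 / 2) x))

end

/-!
# Bounds for sums of ratios of modified Bessel functions

Everything rests on Amos' bounds `F(ν+1,x) ≤ I_{ν+1}(x) / I_ν(x) ≤ F(ν+1/2,x)`
(`besselF_le_besselRatio`, `besselRatio_le_besselF`). Write `I_ν(x) = (x/2)^ν Φ_ν(x²/4)` with the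
entire function `Φ_ν(t) = ∑ t^k / (k! Γ(k+ν+1))`, for which `Φ_ν' = Φ_{ν+1}` and
`Φ_ν = (ν+1) Φ_{ν+1} + t Φ_{ν+2}`. Since `F(ν,x)` is the positive root of `x r² + 2 ν r = x`, the
two bounds say that the quadratic expressions
`t Φ_{ν+1}² + (ν+1) Φ_ν Φ_{ν+1} - Φ_ν²` and `Φ_ν² - (ν+1/2) Φ_ν Φ_{ν+1} - t Φ_{ν+1}²`
are nonnegative. Each of them, call it `Q`, satisfies `t Q' + c Q ≥ 0` with some `c > 0`, that is,
`t ^ c * Q` increases from its value `0` at `t = 0`.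

The terms of `H(ν,x)` are products of consecutive ratios, so the upper Amos bound dominates `H` by a
geometric series, and the lower one bounds its first two terms; this is `besselH_bounds`.

For the Gaussian-type bounds the series is cut at index `[x] - [ν] - 1` and `besselH_bounds` is
applied to the tail. In the finite part `F(ν,x) = exp (-arsinh (ν/x))` lies between
`exp (-ν/x)` and, for `ν ≤ x`, `exp (-α₀ ν/x)`, because `arsinh` is concave on `[0, 1]` with
`arsinh 1 = α₀`. The products of ratios thus become values of a Gaussian, and their sum is compared
with approximations `2y / (t + √(t² + κ))` of the Mills ratio.

* From above, the sum is at most an integral, and the tails of that integral are bounded by the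
  inequalities of Birnbaum and Pollak (`millsApprox_mul_gaussExp_le_gaussTail`,
  `gaussTail_le_millsApprox_mul_gaussExp`).
* From below, Birnbaum's bound is used in a discrete form, `millsApprox_step`, which telescopes.
  The tail subtracted in `𝓛(ν,x)` starts, up to the fractional part of `ν`, one unit further out
  than the telescoping yields. The excess is absorbed in the last term of the sum:
  `millsApprox_le_one_add`, the one place where numerical estimates enter.

As `x → ∞` only the first term of either bound is of order `√x`; the others decay exponentially.
-/

/-! ### The power series of the Bessel functions -/

/-- The power series `Φ_ν(t) = ∑ t^k / (k! Γ(k+ν+1))`, which carries the analytic part of the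
Bessel function: `I_ν(x) = (x/2)^ν Φ_ν(x²/4)`. -/
noncomputable def besselPhi (v t : ℝ) : ℝ :=
  ∑' k : ℕ, t ^ k / ((k.factorial : ℝ) * Real.Gamma ((k : ℝ) + v + 1))

lemma Gamma_le_Gamma_nat_add {v : ℝ} (hv : 0 ≤ v) (k : ℕ) :
    Real.Gamma (v + 1) ≤ Real.Gamma ((k : ℝ) + v + 1) := by
  induction k with
  | zero => simp
  | succ k ih =>
    have h : ((k + 1 : ℕ) : ℝ) + v + 1 = ((k : ℝ) + v + 1) + 1 := by push_cast; ring
    have hk : (0 : ℝ) ≤ k := Nat.cast_nonneg k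
    have hG : 0 < Real.Gamma ((k : ℝ) + v + 1) := Real.Gamma_pos_of_pos (by positivity)
    rw [h, Real.Gamma_add_one (s := (k : ℝ) + v + 1) (by positivity)]
    nlinarith [mul_nonneg (add_nonneg hk hv) hG.le]

lemma Gamma_nat_add_pos {v : ℝ} (hv : 0 ≤ v) (k : ℕ) : 0 < Real.Gamma ((k : ℝ) + v + 1) :=
  Real.Gamma_pos_of_pos (by positivity)

lemma summable_besselPhi {v : ℝ} (hv : 0 ≤ v) (t : ℝ) :
    Summable fun k : ℕ => t ^ k / ((k.factorial : ℝ) * Real.Gamma ((k : ℝ) + v + 1)) := by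
  have hG : 0 < Real.Gamma (v + 1) := Real.Gamma_pos_of_pos (by positivity)
  refine Summable.of_norm_bounded
    (g := fun k : ℕ => (|t| ^ k / (k.factorial : ℝ)) * (Real.Gamma (v + 1))⁻¹)
    ((Real.summable_pow_div_factorial _).mul_right _) fun k => ?_
  have hk := Gamma_le_Gamma_nat_add hv k
  have hk' := Gamma_nat_add_pos hv k
  rw [norm_div, norm_pow, Real.norm_eq_abs, Real.norm_eq_abs,
    abs_of_pos (show 0 < (k.factorial : ℝ) * Real.Gamma ((k : ℝ) + v + 1) by positivity),
    div_mul_eq_div_div, div_eq_mul_inv (|t| ^ k / _)]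
  gcongr

lemma besselPhi_pos {v t : ℝ} (hv : 0 ≤ v) (ht : 0 ≤ t) : 0 < besselPhi v t := by
  refine (summable_besselPhi hv t).tsum_pos (fun k => ?_) 0 ?_
  · have := Gamma_nat_add_pos hv k
    positivity
  · have := Gamma_nat_add_pos hv 0
    positivity

lemma hasDerivAt_besselPhi {v : ℝ} (hv : 0 ≤ v) (t : ℝ) :
    HasDerivAt (besselPhi v) (besselPhi (v + 1) t) t := by
  have hG : 0 < Real.Gamma (v + 1) := Real.Gamma_pos_of_pos (by positivity)
  set R : ℝ := |t| + 1 with hR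
  have hR0 : 0 ≤ R := by positivity
  have key := hasDerivAt_tsum_of_isPreconnected
    (g := fun (k : ℕ) (s : ℝ) => s ^ k / ((k.factorial : ℝ) * Real.Gamma ((k : ℝ) + v + 1)))
    (g' := fun (k : ℕ) (s : ℝ) =>
      (k * s ^ (k - 1)) / ((k.factorial : ℝ) * Real.Gamma ((k : ℝ) + v + 1)))
    (u := fun k : ℕ => k * R ^ (k - 1) / (k.factorial : ℝ) * (Real.Gamma (v + 1))⁻¹)
    (t := Metric.ball 0 R) (y₀ := t) (y := t) ?_ Metric.isOpen_ball
    (convex_ball 0 R).isPreconnected ?_ ?_ (by simp [hR]) (summable_besselPhi hv t)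
    (by simp [hR])
  · suffices e : besselPhi (v + 1) t = ∑' k : ℕ,
        (k * t ^ (k - 1)) / ((k.factorial : ℝ) * Real.Gamma ((k : ℝ) + v + 1)) by
      rw [e]; exact key
    rw [Summable.tsum_eq_zero_add]
    · simp only [CharP.cast_eq_zero, zero_mul, zero_div, zero_add, besselPhi]
      refine tsum_congr fun k => ?_
      rw [Nat.factorial_succ, Nat.add_sub_cancel]
      have h : ((k + 1 : ℕ) : ℝ) + v + 1 = (k : ℝ) + (v + 1) + 1 := by push_cast; ring
      have hk := Gamma_nat_add_pos (show 0 ≤ v + 1 by linarith) k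
      rw [h]
      push_cast
      field_simp
    · rw [← summable_nat_add_iff 1]
      refine (summable_besselPhi (show 0 ≤ v + 1 by linarith) t).congr fun k => ?_
      rw [Nat.factorial_succ, Nat.add_sub_cancel]
      have h : ((k + 1 : ℕ) : ℝ) + v + 1 = (k : ℝ) + (v + 1) + 1 := by push_cast; ring
      have hk := Gamma_nat_add_pos (show 0 ≤ v + 1 by linarith) k
      rw [h]
      push_cast
      field_simp
  · refine Summable.mul_right _ ?_
    rw [← summable_nat_add_iff 1]
    refine (Real.summable_pow_div_factorial R).congr fun k => ?_
    rw [Nat.factorial_succ, Nat.add_sub_cancel]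
    push_cast
    field_simp
  · intro k s _
    exact (hasDerivAt_pow k s).div_const _
  · intro k s hs
    have hs' : |s| ≤ R := by
      have := Metric.mem_ball.1 hs
      rw [Real.dist_eq, sub_zero] at this
      exact this.le
    have hk := Gamma_le_Gamma_nat_add hv k
    have hk' := Gamma_nat_add_pos hv k
    rw [norm_div, norm_mul, norm_pow, Real.norm_eq_abs, Real.norm_eq_abs, Real.norm_eq_abs,
      abs_of_pos (show 0 < (k.factorial : ℝ) * Real.Gamma ((k : ℝ) + v + 1) by positivity),
      Nat.abs_cast, div_mul_eq_div_div, div_eq_mul_inv (k * |s| ^ (k - 1) / _)]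
    gcongr

/-- The three-term recurrence `I_ν - I_{ν+2} = (2(ν+1)/x) I_{ν+1}` in terms of `Φ`. -/
lemma besselPhi_recurrence {v : ℝ} (hv : 0 ≤ v) (t : ℝ) :
    besselPhi v t = (v + 1) * besselPhi (v + 1) t + t * besselPhi (v + 2) t := by
  have h1 := summable_besselPhi (show 0 ≤ v + 1 by linarith) t
  have h2 := summable_besselPhi (show 0 ≤ v + 2 by linarith) t
  have h0 := summable_besselPhi hv t
  unfold besselPhi
  rw [h0.tsum_eq_zero_add, h1.tsum_eq_zero_add, ← tsum_mul_left, mul_add, ← tsum_mul_left,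
    add_assoc ((v + 1) * _), ← Summable.tsum_add (Summable.mul_left (v + 1) ((summable_nat_add_iff 1).2 h1))
      (h2.mul_left t)]
  congr 1
  · have hG := Real.Gamma_pos_of_pos (show 0 < v + 1 by positivity)
    have e : Real.Gamma (v + 1 + 1) = (v + 1) * Real.Gamma (v + 1) :=
      Real.Gamma_add_one (by positivity)
    simp only [pow_zero, Nat.factorial_zero, Nat.cast_one, one_mul, CharP.cast_eq_zero, zero_add, e]
    field_simp
  · refine tsum_congr fun k => ?_
    have hG := Gamma_nat_add_pos (show 0 ≤ v + 1 by positivity) k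
    have e0 : ((k + 1 : ℕ) : ℝ) + v + 1 = (k : ℝ) + (v + 1) + 1 := by push_cast; ring
    have e1 : ((k + 1 : ℕ) : ℝ) + (v + 1) + 1 = ((k : ℝ) + (v + 1) + 1) + 1 := by push_cast; ring
    have e2 : (k : ℝ) + (v + 2) + 1 = ((k : ℝ) + (v + 1) + 1) + 1 := by ring
    rw [e0, e1, e2, Real.Gamma_add_one (s := (k : ℝ) + (v + 1) + 1) (by positivity), Nat.factorial_succ]
    have : (k : ℝ) + (v + 1) + 1 ≠ 0 := by positivity
    push_cast
    field_simp
    ring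

/-! ### Amos' bounds for ratios of Bessel functions -/

/-- A differential inequality `t Q' + c Q ≥ 0` with `c > 0` says that `t ^ c * Q` is nondecreasing;
since it vanishes at `0`, `Q` is nonnegative. -/
lemma nonneg_of_mul_deriv_add_nonneg {Q Q' : ℝ → ℝ} {c : ℝ} (hc : 0 < c)
    (hQ : ∀ t, HasDerivAt Q (Q' t) t) (h : ∀ t, 0 < t → 0 ≤ t * Q' t + c * Q t)
    {t : ℝ} (ht : 0 < t) : 0 ≤ Q t := by
  have hmono : MonotoneOn (fun s : ℝ => s ^ c * Q s) (Set.Ici 0) := by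
    refine monotoneOn_of_hasDerivWithinAt_nonneg (convex_Ici 0)
      (f' := fun s => c * s ^ (c - 1) * Q s + s ^ c * Q' s) ?_ ?_ ?_
    · refine ContinuousOn.mul (fun s _ => ?_) fun s _ => (hQ s).continuousAt.continuousWithinAt
      exact (Real.continuousAt_rpow_const s c (Or.inr hc.le)).continuousWithinAt
    · intro s hs
      rw [interior_Ici] at hs
      exact ((Real.hasDerivAt_rpow_const (Or.inl (ne_of_gt hs))).mul (hQ s)).hasDerivWithinAt
    · intro s hs
      rw [interior_Ici] at hs
      have hs0 : 0 < s := hs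
      have e : s ^ c = s ^ (c - 1) * s := by
        rw [← Real.rpow_add_one hs0.ne']; ring_nf
      have := mul_nonneg (Real.rpow_nonneg hs0.le (c - 1)) (h s hs0)
      rw [e]
      linarith
  have := hmono (Set.mem_Ici.2 le_rfl) (Set.mem_Ici.2 ht.le) ht.le
  simp only [Real.zero_rpow hc.ne', zero_mul] at this
  exact nonneg_of_mul_nonneg_right this (Real.rpow_pos_of_pos ht c)

/-- Equivalent to the Turán inequality `I_ν I_{ν+2} ≤ I_{ν+1}²`. -/
lemma besselPhi_sq_le {v t : ℝ} (hv : 0 ≤ v) (ht : 0 < t) :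
    besselPhi v t ^ 2 ≤
      t * besselPhi (v + 1) t ^ 2 + (v + 1) * (besselPhi v t * besselPhi (v + 1) t) := by
  have h0 := fun s => hasDerivAt_besselPhi hv s
  have h1 := fun s => hasDerivAt_besselPhi (show 0 ≤ v + 1 by linarith) s
  have := nonneg_of_mul_deriv_add_nonneg (c := v + 1) (by linarith)
    (Q := fun s => s * besselPhi (v + 1) s ^ 2 + (v + 1) * (besselPhi v s * besselPhi (v + 1) s)
      - besselPhi v s ^ 2) (fun s =>
        (((hasDerivAt_id s).mul ((h1 s).pow 2)).add
          (((h0 s).mul (h1 s)).const_mul (v + 1))).sub ((h0 s).pow 2)) ?_ ht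
  · linarith
  · intro s hs
    have e := besselPhi_recurrence hv s
    rw [show v + 2 = v + 1 + 1 by ring] at e
    have key : 0 ≤ s * besselPhi (v + 1) s ^ 2 := by positivity
    simp only [id, Pi.pow_apply]
    push_cast
    have e' : s * besselPhi (v + 1 + 1) s = besselPhi v s - (v + 1) * besselPhi (v + 1) s := by
      linarith
    refine key.trans_eq ?_
    linear_combination (-(2 * s * besselPhi (v + 1) s + (v + 1) * besselPhi v s)) * e'

/-- Equivalent to the monotonicity of `I_{ν+1}(x) / I_ν(x)` in `x`, by the Riccati equation of this
ratio. -/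
lemma le_besselPhi_sq {v t : ℝ} (hv : 0 ≤ v) (ht : 0 < t) :
    t * besselPhi (v + 1) t ^ 2 + (v + 1 / 2) * (besselPhi v t * besselPhi (v + 1) t) ≤
      besselPhi v t ^ 2 := by
  have h0 := fun s => hasDerivAt_besselPhi hv s
  have h1 := fun s => hasDerivAt_besselPhi (show 0 ≤ v + 1 by linarith) s
  have := nonneg_of_mul_deriv_add_nonneg (c := v + 1 / 2) (by linarith)
    (Q := fun s => besselPhi v s ^ 2 - (s * besselPhi (v + 1) s ^ 2 +
      (v + 1 / 2) * (besselPhi v s * besselPhi (v + 1) s))) (fun s =>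
        ((h0 s).pow 2).sub (((hasDerivAt_id s).mul ((h1 s).pow 2)).add
          (((h0 s).mul (h1 s)).const_mul (v + 1 / 2)))) ?_ ht
  · linarith
  · intro s hs
    have e := besselPhi_recurrence hv s
    rw [show v + 2 = v + 1 + 1 by ring] at e
    have key : 0 ≤ (v + 1 / 2) / 2 * (besselPhi v s * besselPhi (v + 1) s) := by
      have := besselPhi_pos hv hs.le
      have := besselPhi_pos (show 0 ≤ v + 1 by linarith) hs.le
      positivity
    simp only [id, Pi.pow_apply]
    push_cast
    have e' : s * besselPhi (v + 1 + 1) s = besselPhi v s - (v + 1) * besselPhi (v + 1) s := by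
      linarith
    refine key.trans_eq ?_
    linear_combination ((2 * s * besselPhi (v + 1) s + (v + 1 / 2) * besselPhi v s)) * e'

lemma besselI_eq {v x : ℝ} (hx : 0 < x) :
    besselI v x = (x / 2) ^ v * besselPhi v (x ^ 2 / 4) := by
  unfold besselI besselPhi
  rw [← tsum_mul_left]
  refine tsum_congr fun k => ?_
  rw [Real.rpow_add (by positivity), Real.rpow_mul (by positivity), Real.rpow_natCast]
  rw [show (x / 2) ^ (2 : ℝ) = x ^ 2 / 4 by
    rw [show (2 : ℝ) = ((2 : ℕ) : ℝ) by norm_num, Real.rpow_natCast]; norm_num; ring]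
  ring

lemma besselI_zero_right {v : ℝ} (hv : 0 < v) : besselI v 0 = 0 := by
  unfold besselI
  refine (tsum_congr fun k => ?_).trans tsum_zero
  rw [zero_div, Real.zero_rpow (by positivity), mul_zero]

/-- The ratio `I_{ν+1}(x) / I_ν(x)` (for `x > 0`) of consecutive Bessel functions. -/
noncomputable def besselRatio (v x : ℝ) : ℝ :=
  x / 2 * (besselPhi (v + 1) (x ^ 2 / 4) / besselPhi v (x ^ 2 / 4))

lemma besselRatio_pos {v x : ℝ} (hv : 0 ≤ v) (hx : 0 < x) : 0 < besselRatio v x := by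
  have := besselPhi_pos hv (show 0 ≤ x ^ 2 / 4 by positivity)
  have := besselPhi_pos (show 0 ≤ v + 1 by linarith) (show 0 ≤ x ^ 2 / 4 by positivity)
  unfold besselRatio
  positivity

lemma besselF_nonneg {v x : ℝ} (hv : 0 ≤ v) (hx : 0 ≤ x) : 0 ≤ besselF v x := by
  unfold besselF; positivity

/-- `F(ν,x)` is the positive root of `x r² + 2 ν r = x`. -/
lemma besselF_quadratic {v x : ℝ} (hv : 0 ≤ v) (hx : 0 < x) :
    x * besselF v x ^ 2 + 2 * v * besselF v x = x := by
  have hs : √(v ^ 2 + x ^ 2) ^ 2 = v ^ 2 + x ^ 2 := Real.sq_sqrt (by positivity)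
  have hs0 : 0 < √(v ^ 2 + x ^ 2) := Real.sqrt_pos.2 (by positivity)
  unfold besselF
  field_simp
  linear_combination (-1) * hs

lemma le_besselF {v x r : ℝ} (hv : 0 ≤ v) (hx : 0 < x) (h : x * r ^ 2 + 2 * v * r ≤ x) :
    r ≤ besselF v x := by
  by_contra! hlt
  have hF : 0 < besselF v x := by unfold besselF; positivity
  have := besselF_quadratic hv hx
  nlinarith [mul_pos hx (mul_pos (sub_pos.2 hlt) (by linarith : 0 < r + besselF v x)),
    mul_nonneg hv (sub_pos.2 hlt).le]

lemma besselF_le {v x r : ℝ} (hv : 0 ≤ v) (hx : 0 < x) (hr : 0 ≤ r)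
    (h : x ≤ x * r ^ 2 + 2 * v * r) : besselF v x ≤ r := by
  by_contra! hlt
  have hF : 0 < besselF v x := by unfold besselF; positivity
  have := besselF_quadratic hv hx
  nlinarith [mul_pos hx (mul_pos (sub_pos.2 hlt) (by linarith : 0 < r + besselF v x)),
    mul_nonneg hv (sub_pos.2 hlt).le]

/-- Amos' lower bound for the ratio of consecutive Bessel functions. -/
lemma besselF_le_besselRatio {v x : ℝ} (hv : 0 ≤ v) (hx : 0 < x) :
    besselF (v + 1) x ≤ besselRatio v x := by
  have h0 := besselPhi_pos hv (show 0 ≤ x ^ 2 / 4 by positivity)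
  refine besselF_le (by linarith) hx (besselRatio_pos hv hx).le ?_
  have h := besselPhi_sq_le hv (show 0 < x ^ 2 / 4 by positivity)
  unfold besselRatio
  rw [div_eq_mul_inv (besselPhi (v + 1) _)]
  have e : besselPhi v (x ^ 2 / 4) * (besselPhi v (x ^ 2 / 4))⁻¹ = 1 := mul_inv_cancel₀ h0.ne'
  have h' := mul_le_mul_of_nonneg_left h
    (show 0 ≤ x * (besselPhi v (x ^ 2 / 4))⁻¹ ^ 2 by positivity)
  generalize besselPhi v (x ^ 2 / 4) = a at *
  generalize a⁻¹ = b at *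
  generalize besselPhi (v + 1) (x ^ 2 / 4) = d at *
  have e2 : a ^ 2 * b ^ 2 = 1 := by rw [← mul_pow, e, one_pow]
  calc x = x * b ^ 2 * a ^ 2 := by linear_combination (-x) * e2
    _ ≤ _ := h'
    _ = _ := by linear_combination (x * (v + 1) * d * b) * e

/-- Amos' upper bound for the ratio of consecutive Bessel functions. -/
lemma besselRatio_le_besselF {v x : ℝ} (hv : 0 ≤ v) (hx : 0 < x) :
    besselRatio v x ≤ besselF (v + 1 / 2) x := by
  have h0 := besselPhi_pos hv (show 0 ≤ x ^ 2 / 4 by positivity)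
  refine le_besselF (by linarith) hx ?_
  have h := le_besselPhi_sq hv (show 0 < x ^ 2 / 4 by positivity)
  unfold besselRatio
  rw [div_eq_mul_inv (besselPhi (v + 1) _)]
  have e : besselPhi v (x ^ 2 / 4) * (besselPhi v (x ^ 2 / 4))⁻¹ = 1 := mul_inv_cancel₀ h0.ne'
  have h' := mul_le_mul_of_nonneg_left h
    (show 0 ≤ x * (besselPhi v (x ^ 2 / 4))⁻¹ ^ 2 by positivity)
  generalize besselPhi v (x ^ 2 / 4) = a at *
  generalize a⁻¹ = b at *
  generalize besselPhi (v + 1) (x ^ 2 / 4) = d at *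
  have e2 : a ^ 2 * b ^ 2 = 1 := by rw [← mul_pow, e, one_pow]
  calc _ = _ := by linear_combination (-(x * (v + 1 / 2) * d * b)) * e
    _ ≤ _ := h'
    _ = x := by linear_combination x * e2

/-! ### The function `F` and exponentials -/

lemma besselF_pos {v x : ℝ} (hv : 0 ≤ v) (hx : 0 < x) : 0 < besselF v x := by
  unfold besselF; positivity

lemma besselF_lt_one {v x : ℝ} (hv : 0 < v) (hx : 0 < x) : besselF v x < 1 := by
  have h := besselF_quadratic hv.le hx
  have h0 := besselF_pos hv.le hx
  by_contra! h1
  nlinarith [mul_pos hv h0, mul_le_mul_of_nonneg_left (one_le_pow₀ h1 (n := 2)) hx.le]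

lemma besselF_le_one {v x : ℝ} (hv : 0 ≤ v) (hx : 0 < x) : besselF v x ≤ 1 :=
  besselF_le hv hx zero_le_one (by nlinarith)

lemma besselF_anti {v w x : ℝ} (hv : 0 ≤ v) (hvw : v ≤ w) (hx : 0 < x) :
    besselF w x ≤ besselF v x := by
  refine besselF_le (hv.trans hvw) hx (besselF_pos hv hx).le ?_
  nlinarith [besselF_quadratic hv hx, mul_le_mul_of_nonneg_right hvw (besselF_pos hv hx).le]

/-- `F(ν,x) = exp (-arsinh (ν/x))`, in the form of the comparison with `exp (-s)`. -/
lemma exp_neg_le_besselF_of_le_sinh {v x s : ℝ} (hv : 0 ≤ v) (hx : 0 < x)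
    (h : v ≤ x * Real.sinh s) : Real.exp (-s) ≤ besselF v x := by
  refine le_besselF hv hx ?_
  have e : Real.exp s * Real.exp (-s) = 1 := by rw [← Real.exp_add]; simp
  rw [Real.sinh_eq] at h
  have := mul_le_mul_of_nonneg_right h (Real.exp_pos (-s)).le
  nlinarith

lemma besselF_le_exp_neg_of_sinh_le {v x s : ℝ} (hv : 0 ≤ v) (hx : 0 < x)
    (h : x * Real.sinh s ≤ v) : besselF v x ≤ Real.exp (-s) := by
  refine besselF_le hv hx (Real.exp_pos _).le ?_
  have e : Real.exp s * Real.exp (-s) = 1 := by rw [← Real.exp_add]; simp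
  rw [Real.sinh_eq] at h
  have := mul_le_mul_of_nonneg_right h (Real.exp_pos (-s)).le
  nlinarith

lemma exp_neg_div_le_besselF {v x : ℝ} (hv : 0 ≤ v) (hx : 0 < x) :
    Real.exp (-(v / x)) ≤ besselF v x := by
  refine exp_neg_le_besselF_of_le_sinh hv hx ?_
  have h := Real.self_le_sinh_iff.2 (show 0 ≤ v / x by positivity)
  calc v = x * (v / x) := by field_simp
    _ ≤ _ := by gcongr

lemma exp_besselAlpha : Real.exp besselAlpha = √2 + 1 := by
  have h2 : √2 ^ 2 = 2 := Real.sq_sqrt (by norm_num)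
  have h1 : 1 < √2 := Real.lt_sqrt_of_sq_lt (by norm_num)
  unfold besselAlpha
  rw [Real.exp_neg, Real.exp_log (by linarith)]
  have : √2 - 1 ≠ 0 := by linarith
  field_simp
  nlinarith

lemma besselAlpha_pos : 0 < besselAlpha := by
  rw [← Real.exp_lt_exp, exp_besselAlpha, Real.exp_zero]
  have : 0 < √2 := by positivity
  linarith

lemma sinh_besselAlpha : Real.sinh besselAlpha = 1 := by
  have h2 : √2 ^ 2 = 2 := Real.sq_sqrt (by norm_num)
  have h0 : 0 < √2 := by positivity
  rw [Real.sinh_eq, Real.exp_neg, exp_besselAlpha]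
  field_simp
  nlinarith

lemma convexOn_sinh : ConvexOn ℝ (Set.Ici 0) Real.sinh := by
  refine MonotoneOn.convexOn_of_deriv (convex_Ici 0) Real.continuous_sinh.continuousOn
    Real.differentiable_sinh.differentiableOn ?_
  rw [Real.deriv_sinh]
  exact Real.cosh_strictMonoOn.monotoneOn.mono interior_subset

/-- Since `sinh` is convex with `sinh 0 = 0` and `sinh α₀ = 1`, it lies below its chord on
`[0, α₀]`, which bounds `arsinh` from below by `α₀ t` on `[0, 1]`. -/
lemma besselF_le_exp_neg {v x : ℝ} (hv : 0 ≤ v) (hx : 0 < x) (hvx : v ≤ x) :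
    besselF v x ≤ Real.exp (-(besselAlpha / x * v)) := by
  refine besselF_le_exp_neg_of_sinh_le hv hx ?_
  have h := convexOn_sinh.2 (Set.mem_Ici.2 le_rfl) (Set.mem_Ici.2 besselAlpha_pos.le)
    (sub_nonneg.2 ((div_le_one hx).2 hvx)) (show 0 ≤ v / x by positivity) (by ring)
  simp only [smul_eq_mul, mul_zero, zero_add, Real.sinh_zero, sinh_besselAlpha, mul_one] at h
  rw [show besselAlpha / x * v = v / x * besselAlpha by ring]
  calc _ ≤ x * (v / x) := by gcongr
    _ = v := by field_simp

/-! ### The series `H` -/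

lemma besselI_pos {v x : ℝ} (hv : 0 ≤ v) (hx : 0 < x) : 0 < besselI v x := by
  rw [besselI_eq hx]
  have := besselPhi_pos hv (show 0 ≤ x ^ 2 / 4 by positivity)
  positivity

lemma besselI_succ {v x : ℝ} (hv : 0 ≤ v) (hx : 0 < x) :
    besselI (v + 1) x = besselI v x * besselRatio v x := by
  rw [besselI_eq hx, besselI_eq hx, besselRatio, Real.rpow_add_one (by positivity)]
  have := besselPhi_pos hv (show 0 ≤ x ^ 2 / 4 by positivity)
  field_simp

lemma besselHTerm_pos {v x : ℝ} (hv : 0 ≤ v) (hx : 0 < x) (k : ℕ) : 0 < besselHTerm v x k :=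
  div_pos (besselI_pos (by positivity) hx) (besselI_pos hv hx)

lemma besselHTerm_zero {v x : ℝ} (hv : 0 ≤ v) (hx : 0 < x) :
    besselHTerm v x 0 = besselRatio v x := by
  have := besselI_pos hv hx
  unfold besselHTerm
  rw [Nat.cast_zero, zero_add, besselI_succ hv hx]
  field_simp

lemma besselHTerm_succ {v x : ℝ} (hv : 0 ≤ v) (hx : 0 < x) (k : ℕ) :
    besselHTerm v x (k + 1) = besselHTerm v x k * besselRatio (v + k + 1) x := by
  unfold besselHTerm
  rw [show v + (((k + 1 : ℕ) : ℝ) + 1) = v + k + 1 + 1 by push_cast; ring,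
    besselI_succ (by positivity) hx, show v + ((k : ℝ) + 1) = v + k + 1 by ring]
  ring

lemma besselHTerm_add {v x : ℝ} (hv : 0 ≤ v) (hx : 0 < x) (N k : ℕ) :
    besselHTerm v x (k + (N + 1)) = besselHTerm v x N * besselHTerm (v + (N + 1)) x k := by
  have h := besselI_pos (show 0 ≤ v + (N + 1) by positivity) hx
  unfold besselHTerm
  rw [show v + (((k + (N + 1) : ℕ) : ℝ) + 1) = v + (N + 1) + (k + 1) by push_cast; ring]
  field_simp

lemma besselHTerm_le_geometric {v x : ℝ} (hv : 0 ≤ v) (hx : 0 < x) (k : ℕ) :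
    besselHTerm v x k ≤ besselF (v + 1 / 2) x * besselF (v + 3 / 2) x ^ k := by
  induction k with
  | zero => simpa [besselHTerm_zero hv hx] using besselRatio_le_besselF hv hx
  | succ k ih =>
    have hk : (0 : ℝ) ≤ k := Nat.cast_nonneg k
    rw [besselHTerm_succ hv hx, pow_succ, ← mul_assoc]
    have h1 : besselRatio (v + k + 1) x ≤ besselF (v + 3 / 2) x :=
      (besselRatio_le_besselF (by positivity) hx).trans
        (besselF_anti (by linarith) (by linarith) hx)
    have := besselF_nonneg (show 0 ≤ v + 1 / 2 by linarith) hx.le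
    have := besselF_nonneg (show 0 ≤ v + 3 / 2 by linarith) hx.le
    exact mul_le_mul ih h1 (besselRatio_pos (by positivity) hx).le (by positivity)

lemma summable_besselHTerm {v x : ℝ} (hv : 0 ≤ v) (hx : 0 < x) : Summable (besselHTerm v x) :=
  Summable.of_nonneg_of_le (fun k => (besselHTerm_pos hv hx k).le) (besselHTerm_le_geometric hv hx)
    ((summable_geometric_of_lt_one (besselF_nonneg (by linarith) hx.le)
      (besselF_lt_one (by linarith) hx)).mul_left _)

lemma besselH_le {v x : ℝ} (hv : 0 ≤ v) (hx : 0 < x) :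
    besselH v x ≤ besselF (v + 1 / 2) x / (1 - besselF (v + 3 / 2) x) := by
  have h0 := besselF_nonneg (show 0 ≤ v + 3 / 2 by linarith) hx.le
  have h1 := besselF_lt_one (show 0 < v + 3 / 2 by linarith) hx
  refine ((summable_besselHTerm hv hx).tsum_le_tsum (besselHTerm_le_geometric hv hx)
    ((summable_geometric_of_lt_one h0 h1).mul_left _)).trans_eq ?_
  rw [tsum_mul_left, tsum_geometric_of_lt_one h0 h1, ← div_eq_mul_inv]

lemma le_besselH {v x : ℝ} (hv : 0 ≤ v) (hx : 0 < x) :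
    besselF (v + 1) x * (1 + besselF (v + 2) x) ≤ besselH v x := by
  refine le_trans ?_ ((summable_besselHTerm hv hx).sum_le_tsum (Finset.range 2)
    fun k _ => (besselHTerm_pos hv hx k).le)
  have h0 := besselF_le_besselRatio hv hx
  have h1 := besselF_le_besselRatio (show 0 ≤ v + 1 by linarith) hx
  rw [show v + 1 + 1 = v + 2 by ring] at h1
  have := besselF_nonneg (show 0 ≤ v + 1 by linarith) hx.le
  have := besselF_nonneg (show 0 ≤ v + 2 by linarith) hx.le
  rw [Finset.sum_range_succ, Finset.sum_range_one, besselHTerm_succ hv hx, besselHTerm_zero hv hx,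
    Nat.cast_zero, add_zero]
  nlinarith [mul_le_mul h0 h1 this (by linarith)]

lemma besselH_eq_sum_add {v x : ℝ} (hv : 0 ≤ v) (hx : 0 < x) (N : ℕ) :
    besselH v x = ∑ k ∈ Finset.range (N + 1), besselHTerm v x k
      + besselHTerm v x N * besselH (v + (N + 1)) x := by
  unfold besselH
  rw [← (summable_besselHTerm hv hx).sum_add_tsum_nat_add (N + 1), ← tsum_mul_left]
  simp only [besselHTerm_add hv hx]

lemma besselHTerm_zero_right {v : ℝ} (hv : 0 ≤ v) (k : ℕ) : besselHTerm v 0 k = 0 := by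
  unfold besselHTerm
  rw [besselI_zero_right (by positivity), zero_div]

lemma besselH_bounds {v x : ℝ} (hv : 0 ≤ v) (hx : 0 ≤ x) :
    Summable (besselHTerm v x) ∧
      besselF (v + 1) x * (1 + besselF (v + 2) x) ≤ besselH v x ∧
      besselH v x ≤ besselF (v + 1 / 2) x / (1 - besselF (v + 3 / 2) x) := by
  rcases hx.eq_or_lt with rfl | hx
  · have h : besselHTerm v 0 = fun _ => 0 := funext (besselHTerm_zero_right hv)
    simp [besselH, h, besselF, summable_zero]
  · exact ⟨summable_besselHTerm hv hx, le_besselH hv hx, besselH_le hv hx⟩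

lemma exp_le_besselHTerm {v x : ℝ} (hv : 0 ≤ v) (hx : 0 < x) (k : ℕ) :
    Real.exp (-((k + 1) * (2 * v + k + 2) / (2 * x))) ≤ besselHTerm v x k := by
  induction k with
  | zero =>
    rw [besselHTerm_zero hv hx]
    refine le_trans (le_of_eq ?_) ((exp_neg_div_le_besselF (show 0 ≤ v + 1 by linarith) hx).trans
      (besselF_le_besselRatio hv hx))
    congr 1
    push_cast
    field_simp
    ring
  | succ k ih =>
    rw [besselHTerm_succ hv hx]
    have h := (exp_neg_div_le_besselF (show 0 ≤ v + k + 1 + 1 by positivity) hx).trans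
      (besselF_le_besselRatio (by positivity) hx)
    refine le_trans (le_of_eq ?_) (mul_le_mul ih h (Real.exp_pos _).le (besselHTerm_pos hv hx k).le)
    rw [← Real.exp_add]
    congr 1
    push_cast
    field_simp
    ring

lemma besselHTerm_le_exp {v x : ℝ} (hv : 0 ≤ v) (hx : 0 < x) (k : ℕ) (hk : v + k + 1 / 2 ≤ x) :
    besselHTerm v x k ≤ Real.exp (-(besselAlpha / (2 * x) * ((k + 1) * (2 * v + k + 1)))) := by
  induction k with
  | zero =>
    rw [besselHTerm_zero hv hx]
    refine le_trans ((besselRatio_le_besselF hv hx).trans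
      (besselF_le_exp_neg (by linarith) hx (by simpa using hk))) (le_of_eq ?_)
    congr 1
    push_cast
    field_simp
    ring
  | succ k ih =>
    push_cast at hk
    rw [besselHTerm_succ hv hx]
    have h := (besselRatio_le_besselF (show 0 ≤ v + k + 1 by positivity) hx).trans
      (besselF_le_exp_neg (by positivity) hx (by linarith))
    refine le_trans (mul_le_mul (ih (by linarith)) h
      (besselRatio_pos (by positivity) hx).le (Real.exp_pos _).le) (le_of_eq ?_)
    rw [← Real.exp_add]
    congr 1
    push_cast
    field_simp
    ring

/-! ### Approximations of the Mills ratio -/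

/-- The function `2y / (t + √(t² + κ))`. For `κ = 4y` it bounds the Mills ratio
`exp (t²/(2y)) ∫_t^∞ exp (-s²/(2y)) ds` of the Gaussian with variance `y` from below, and for
`κ = 8y/π` from above. -/
noncomputable def millsApprox (y κ t : ℝ) : ℝ :=
  2 * y / (t + √(t ^ 2 + κ))

/-- The unnormalised Gaussian density with variance `y`. -/
noncomputable def gaussExp (y t : ℝ) : ℝ :=
  Real.exp (-(t ^ 2 / (2 * y)))

lemma gaussExp_pos (y t : ℝ) : 0 < gaussExp y t := Real.exp_pos _

lemma gaussExp_anti {y s t : ℝ} (hy : 0 < y) (hs : 0 ≤ s) (hst : s ≤ t) :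
    gaussExp y t ≤ gaussExp y s := by
  unfold gaussExp
  gcongr

lemma millsApprox_pos {y κ t : ℝ} (hy : 0 < y) (hκ : 0 < κ) (ht : 0 ≤ t) :
    0 < millsApprox y κ t := by
  unfold millsApprox; positivity

lemma millsApprox_anti {y κ s t : ℝ} (hy : 0 < y) (hκ : 0 < κ) (hs : 0 ≤ s) (hst : s ≤ t) :
    millsApprox y κ t ≤ millsApprox y κ s := by
  unfold millsApprox
  gcongr

/-- `millsApprox y κ t` is the positive root of `κ q² + 4 y t q = 4 y²`. -/
lemma millsApprox_quadratic {y κ t : ℝ} (hκ : 0 < κ) (ht : 0 ≤ t) :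
    κ * millsApprox y κ t ^ 2 + 4 * y * t * millsApprox y κ t = 4 * y ^ 2 := by
  have hs : √(t ^ 2 + κ) ^ 2 = t ^ 2 + κ := Real.sq_sqrt (by positivity)
  have hs0 : 0 < √(t ^ 2 + κ) := Real.sqrt_pos.2 (by positivity)
  unfold millsApprox
  field_simp
  linear_combination (-4 * y ^ 2) * hs

lemma millsApprox_le {y κ t q : ℝ} (hy : 0 < y) (hκ : 0 < κ) (ht : 0 ≤ t) (hq : 0 ≤ q)
    (h : 4 * y ^ 2 ≤ κ * q ^ 2 + 4 * y * t * q) : millsApprox y κ t ≤ q := by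
  by_contra! hlt
  have h1 := millsApprox_quadratic (y := y) hκ ht
  have h2 := millsApprox_pos hy hκ ht
  nlinarith [mul_pos hκ (mul_pos (sub_pos.2 hlt) (by linarith : 0 < millsApprox y κ t + q)),
    mul_nonneg (mul_nonneg hy.le ht) (sub_pos.2 hlt).le]

lemma le_millsApprox {y κ t q : ℝ} (hy : 0 < y) (hκ : 0 < κ) (ht : 0 ≤ t)
    (h : κ * q ^ 2 + 4 * y * t * q ≤ 4 * y ^ 2) : q ≤ millsApprox y κ t := by
  by_contra! hlt
  have h1 := millsApprox_quadratic (y := y) hκ ht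
  have h2 := millsApprox_pos hy hκ ht
  nlinarith [mul_pos hκ (mul_pos (sub_pos.2 hlt) (by linarith : 0 < millsApprox y κ t + q)),
    mul_nonneg (mul_nonneg hy.le ht) (sub_pos.2 hlt).le]

lemma hasDerivAt_gaussExp (y t : ℝ) :
    HasDerivAt (gaussExp y) (-(t / y) * gaussExp y t) t := by
  have h := (((hasDerivAt_pow 2 t).div_const (2 * y)).neg).exp
  refine h.congr_deriv ?_
  simp only [gaussExp, Pi.neg_apply]
  rcases eq_or_ne y 0 with rfl | hy
  · simp
  · push_cast
    field_simp

lemma hasDerivAt_millsApprox_mul_gaussExp {y κ t : ℝ} (hκ : 0 < κ) (ht : 0 ≤ t) :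
    HasDerivAt (fun s => millsApprox y κ s * gaussExp y s)
      (-(millsApprox y κ t * (1 / √(t ^ 2 + κ) + t / y)) * gaussExp y t) t := by
  have hs0 : 0 < √(t ^ 2 + κ) := Real.sqrt_pos.2 (by positivity)
  have h1 : HasDerivAt (fun s : ℝ => s + √(s ^ 2 + κ)) (1 + t / √(t ^ 2 + κ)) t := by
    refine (hasDerivAt_id t).add ((((hasDerivAt_pow 2 t).add_const κ).sqrt
      (by positivity)).congr_deriv ?_)
    push_cast
    field_simp
  have h2 := (h1.fun_inv (by positivity)).const_mul (2 * y)
  refine (HasDerivAt.mul (c := millsApprox y κ) (h2.congr_of_eventuallyEq ?_)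
    (hasDerivAt_gaussExp y t)).congr_deriv ?_
  · exact Eventually.of_forall fun s => by simp only [millsApprox, div_eq_mul_inv]
  · unfold millsApprox
    rcases eq_or_ne y 0 with rfl | hy
    · simp
    · field_simp
      ring

lemma millsApprox_mul_le_one {y t : ℝ} (hy : 0 < y) (ht : 0 ≤ t) :
    millsApprox y (4 * y) t * (1 / √(t ^ 2 + 4 * y) + t / y) ≤ 1 := by
  have hs : √(t ^ 2 + 4 * y) ^ 2 = t ^ 2 + 4 * y := Real.sq_sqrt (by positivity)
  have hs0 : 0 < √(t ^ 2 + 4 * y) := Real.sqrt_pos.2 (by positivity)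
  have hts : t * √(t ^ 2 + 4 * y) ≤ t ^ 2 + 2 * y := by
    nlinarith [sq_nonneg (√(t ^ 2 + 4 * y) - t)]
  unfold millsApprox
  rw [show 2 * y / (t + √(t ^ 2 + 4 * y)) * (1 / √(t ^ 2 + 4 * y) + t / y)
    = 2 * (y + t * √(t ^ 2 + 4 * y)) / ((t + √(t ^ 2 + 4 * y)) * √(t ^ 2 + 4 * y)) by
      field_simp, div_le_one (by positivity)]
  nlinarith

/-- Discrete form of the lower bound for the Mills ratio: the decrement of the approximate
Gaussian tail over a unit step is at most the value of the density at the left endpoint. -/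
lemma millsApprox_step {y c : ℝ} (hy : 0 < y) (hc : 0 ≤ c) :
    millsApprox y (4 * y) c * gaussExp y c ≤
      gaussExp y c + millsApprox y (4 * y) (c + 1) * gaussExp y (c + 1) := by
  have hd : ∀ t ∈ Set.Ici c, HasDerivAt
      (fun s => millsApprox y (4 * y) s * gaussExp y s + s * gaussExp y c)
      (-(millsApprox y (4 * y) t * (1 / √(t ^ 2 + 4 * y) + t / y)) * gaussExp y t
        + 1 * gaussExp y c) t := fun t ht =>
    (hasDerivAt_millsApprox_mul_gaussExp (by positivity) (hc.trans ht)).add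
      ((hasDerivAt_id t).mul_const _)
  have hmono : MonotoneOn
      (fun s => millsApprox y (4 * y) s * gaussExp y s + s * gaussExp y c) (Set.Ici c) := by
    refine monotoneOn_of_hasDerivWithinAt_nonneg (convex_Ici c)
      (fun t ht => (hd t ht).continuousAt.continuousWithinAt)
      (fun t ht => (hd t (interior_subset ht)).hasDerivWithinAt) fun t ht => ?_
    have ht : c ≤ t := interior_subset ht
    have h1 := millsApprox_mul_le_one hy (hc.trans ht)
    have h2 := gaussExp_anti hy hc ht
    nlinarith [gaussExp_pos y t]
  have := hmono (Set.mem_Ici.2 le_rfl) (Set.mem_Ici.2 (by linarith : c ≤ c + 1)) (by linarith)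
  simp only at this
  linarith

lemma millsApprox_le_sum_add {y c : ℝ} (hy : 0 < y) (hc : 0 ≤ c) (N : ℕ) :
    millsApprox y (4 * y) c * gaussExp y c ≤
      ∑ k ∈ Finset.range N, gaussExp y (c + k)
        + millsApprox y (4 * y) (c + N) * gaussExp y (c + N) := by
  induction N with
  | zero => simp
  | succ N ih =>
    have := millsApprox_step hy (show 0 ≤ c + N by positivity)
    rw [Finset.sum_range_succ]
    push_cast
    rw [← add_assoc c]
    linarith

/-! ### The lower bound for `H` -/

lemma exp_neg_two_ge : (0.135 : ℝ) ≤ Real.exp (-2) := by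
  rw [Real.exp_neg, le_inv_comm₀ (by norm_num) (Real.exp_pos _),
    show (2 : ℝ) = 1 + 1 by norm_num, Real.exp_add]
  nlinarith [Real.exp_one_lt_d9, Real.exp_pos 1]

lemma exp_neg_five_thirds_ge : (0.1888 : ℝ) ≤ Real.exp (-(5 / 3)) := by
  refine le_of_pow_le_pow_left₀ (n := 3) (by norm_num) (Real.exp_pos _).le ?_
  have h : Real.exp (-(5 / 3)) ^ 3 = (Real.exp 1 ^ 5)⁻¹ := by
    rw [← Real.exp_nat_mul, ← Real.exp_nat_mul, ← Real.exp_neg]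
    norm_num
  rw [h, le_inv_comm₀ (by norm_num) (by positivity)]
  refine (pow_le_pow_left₀ (Real.exp_pos 1).le Real.exp_one_lt_d9.le 5).trans ?_
  norm_num

lemma exp_neg_seven_fourths_ge : (0.17 : ℝ) ≤ Real.exp (-(7 / 4)) := by
  refine le_of_pow_le_pow_left₀ (n := 4) (by norm_num) (Real.exp_pos _).le ?_
  have h : Real.exp (-(7 / 4)) ^ 4 = (Real.exp 1 ^ 7)⁻¹ := by
    rw [← Real.exp_nat_mul, ← Real.exp_nat_mul, ← Real.exp_neg]
    norm_num
  rw [h, le_inv_comm₀ (by norm_num) (by positivity)]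
  refine (pow_le_pow_left₀ (Real.exp_pos 1).le Real.exp_one_lt_d9.le 7).trans ?_
  norm_num

lemma le_millsApprox_pi {x b d : ℝ} (hx : 0 < x) (hb : 0 ≤ b)
    (h : b * d + 0.637 * d ^ 2 ≤ x) : d ≤ millsApprox x (8 * x / Real.pi) b := by
  have hpi := Real.pi_pos
  refine le_millsApprox hx (by positivity) hb ?_
  have h1 : 2 / Real.pi ≤ 0.637 := by
    rw [div_le_iff₀ hpi]
    linarith [Real.pi_gt_d4]
  have h2 : 2 / Real.pi * d ^ 2 + b * d ≤ x := by
    nlinarith [mul_le_mul_of_nonneg_right h1 (sq_nonneg d)]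
  calc 8 * x / Real.pi * d ^ 2 + 4 * x * b * d = 4 * x * (2 / Real.pi * d ^ 2 + b * d) := by
        field_simp; ring
    _ ≤ 4 * x * x := by gcongr
    _ = 4 * x ^ 2 := by ring

lemma millsApprox_four_le {x a q : ℝ} (hx : 0 < x) (ha : 0 ≤ a) (hq : 0 ≤ q)
    (h : x ≤ q ^ 2 + a * q) : millsApprox x (4 * x) a ≤ q := by
  refine millsApprox_le hx (by positivity) ha hq ?_
  nlinarith [mul_le_mul_of_nonneg_left h hx.le]

/-- The worst case `ν_f = 0` of `millsApprox_le_one_add`. For `n ≥ 4` the gain on the right is at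
least `0.7 * 0.135 > 1 / (2n+3)`, which already exceeds what is needed; for `n = 2, 3` the margin is
small near `x = n + 1`, so the estimates are expanded to first order in `u = n + 1 - x`. -/
lemma millsApprox_le_one_add_zero_fract {n : ℕ} {x : ℝ} (hn : 2 ≤ n) (hx : n + 1 / 2 ≤ x)
    (hx' : x ≤ n + 1) :
    millsApprox x (4 * x) (n - 1 / 2) ≤ 1 +
      millsApprox x (8 * x / Real.pi) (n + 3 / 2) * Real.exp (-((2 * n + 1) / x)) := by
  have hn' : (2 : ℝ) ≤ n := by exact_mod_cast hn
  have hx0 : 0 < x := by linarith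
  have combine : ∀ d e : ℝ, 0 ≤ d → 0 ≤ e → (n + 3 / 2) * d + 0.637 * d ^ 2 ≤ x →
      e ≤ Real.exp (-((2 * n + 1) / x)) → x ≤ (1 + d * e) ^ 2 + (n - 1 / 2) * (1 + d * e) →
      millsApprox x (4 * x) (n - 1 / 2) ≤ 1 +
      millsApprox x (8 * x / Real.pi) (n + 3 / 2) * Real.exp (-((2 * n + 1) / x)) := by
    intro d e hd he h1 h2 h3
    refine (millsApprox_four_le hx0 (by linarith) (by positivity) h3).trans ?_
    have := le_millsApprox_pi hx0 (by linarith) h1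
    have := hd.trans this
    gcongr
  -- it suffices to give lower bounds `d`, `e` for the two factors, with `1 + d * e` above the
  -- positive root of `q² + (n - 1/2) q = x`, which is the left-hand side
  obtain rfl | rfl | h4 : n = 2 ∨ n = 3 ∨ 4 ≤ n := by omega
  · obtain ⟨u, rfl⟩ : ∃ u, x = 3 - u := ⟨3 - x, by ring⟩
    push_cast at *
    have hu0 : 0 ≤ u := by linarith
    have hu1 : u ≤ 1 / 2 := by linarith
    refine combine (0.753 - 0.23 * u) (0.1888 * (1 - 2 / 3 * u)) (by linarith) (by linarith)
      (by nlinarith) ?_ ?_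
    · have h1 : (2 * 2 + 1) / (3 - u) ≤ 5 / 3 + 2 / 3 * u := by
        rw [div_le_iff₀ hx0]; nlinarith
      calc 0.1888 * (1 - 2 / 3 * u)
          ≤ Real.exp (-(5 / 3)) * (-(2 / 3 * u) + 1) := by
            refine mul_le_mul exp_neg_five_thirds_ge (by linarith) (by linarith)
              (Real.exp_pos _).le
        _ ≤ Real.exp (-(5 / 3)) * Real.exp (-(2 / 3 * u)) := by
            gcongr; exact Real.add_one_le_exp _
        _ = Real.exp (-(5 / 3 + 2 / 3 * u)) := by rw [← Real.exp_add]; ring_nf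
        _ ≤ _ := by gcongr
    · have h1 : 0.139 - 0.2 * u ≤ (0.753 - 0.23 * u) * (0.1888 * (1 - 2 / 3 * u)) := by nlinarith
      have h2 := pow_le_pow_left₀ (by linarith) (add_le_add_right h1 1) 2
      nlinarith
  · obtain ⟨u, rfl⟩ : ∃ u, x = 4 - u := ⟨4 - x, by ring⟩
    push_cast at *
    have hu0 : 0 ≤ u := by linarith
    have hu1 : u ≤ 1 / 2 := by linarith
    refine combine (0.79 - 0.2 * u) (0.17 * (1 - 0.525 * u)) (by linarith) (by linarith)
      (by nlinarith) ?_ ?_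
    · have h1 : (2 * 3 + 1) / (4 - u) ≤ 7 / 4 + 0.525 * u := by
        rw [div_le_iff₀ hx0]; nlinarith
      calc 0.17 * (1 - 0.525 * u)
          ≤ Real.exp (-(7 / 4)) * (-(0.525 * u) + 1) := by
            refine mul_le_mul exp_neg_seven_fourths_ge (by linarith) (by linarith)
              (Real.exp_pos _).le
        _ ≤ Real.exp (-(7 / 4)) * Real.exp (-(0.525 * u)) := by
            gcongr; exact Real.add_one_le_exp _
        _ = Real.exp (-(7 / 4 + 0.525 * u)) := by rw [← Real.exp_add]; ring_nf
        _ ≤ _ := by gcongr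
    · have h1 : (1 - 2 * u) / 9 ≤ (0.79 - 0.2 * u) * (0.17 * (1 - 0.525 * u)) := by nlinarith
      have h2 := pow_le_pow_left₀ (by linarith) (add_le_add_right h1 1) 2
      nlinarith
  · have h4' : (4 : ℝ) ≤ n := by exact_mod_cast h4
    refine combine 0.7 0.135 (by norm_num) (by norm_num) (by nlinarith) ?_ (by nlinarith)
    refine exp_neg_two_ge.trans ?_
    have : (2 * n + 1) / x ≤ 2 := by rw [div_le_iff₀ hx0]; linarith
    gcongr

/-- With `n = [x]` and `f = ν_f`, the last term of the finite sum (normalised to `1`) together with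
the tail that `𝓛(ν,x)` subtracts dominates the tail left over by telescoping up to that term. -/
lemma millsApprox_le_one_add {n : ℕ} {x f : ℝ} (hn : 2 ≤ n) (hx : n ≤ x) (hx' : x ≤ n + 1)
    (hf : 0 ≤ f) :
    millsApprox x (4 * x) (n - 1 / 2 + f) ≤ 1 +
      millsApprox x (8 * x / Real.pi) (n + 3 / 2)
        * Real.exp (-((1 - f) * (2 * n + 1) / x)) := by
  have hn' : (2 : ℝ) ≤ n := by exact_mod_cast hn
  have hx0 : 0 < x := by linarith
  have hB := millsApprox_pos (t := (n : ℝ) + 3 / 2) hx0 (show 0 < 8 * x / Real.pi by positivity)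
    (by linarith)
  rcases le_or_gt x (n + 1 / 2 + f) with h | h
  · have := millsApprox_four_le (a := n - 1 / 2 + f) hx0 (by linarith) zero_le_one (by linarith)
    have : 0 < millsApprox x (8 * x / Real.pi) (n + 3 / 2)
        * Real.exp (-((1 - f) * (2 * n + 1) / x)) := by positivity
    linarith
  · refine (millsApprox_anti hx0 (by positivity) (by linarith)
      (show (n : ℝ) - 1 / 2 ≤ n - 1 / 2 + f by linarith)).trans
      ((millsApprox_le_one_add_zero_fract hn (by linarith) hx').trans ?_)
    gcongr
    nlinarith

lemma gaussExp_shift (y a c : ℝ) :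
    Real.exp (a ^ 2 / (2 * y)) * gaussExp y c = Real.exp (-((c ^ 2 - a ^ 2) / (2 * y))) := by
  rw [gaussExp, ← Real.exp_add]
  ring_nf

/-- For `[ν] + 2 ≤ [x]`, the finite part of `H` consists of the terms with indices `0, …, N`, where
`[x] = [ν] + N + 2`. -/
lemma exists_floor_eq {v x : ℝ} (hv : 0 ≤ v) (h : ⌊v⌋ + 2 ≤ ⌊x⌋) :
    ∃ m N : ℕ, (⌊v⌋ : ℝ) = m ∧ (⌊x⌋ : ℝ) = m + N + 2 := by
  obtain ⟨m, hm⟩ := Int.eq_ofNat_of_zero_le (Int.floor_nonneg.2 hv)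
  obtain ⟨N, hN⟩ := Int.eq_ofNat_of_zero_le (sub_nonneg.2 h)
  refine ⟨m, N, by rw [hm]; simp, ?_⟩
  have : ⌊x⌋ = m + N + 2 := by omega
  rw [this]; push_cast; ring

lemma besselLower_le_besselH {v x : ℝ} (hv : 0 ≤ v) (h : ⌊v⌋ + 2 ≤ ⌊x⌋) :
    besselLower v x ≤ besselH v x := by
  obtain ⟨m, N, hm, hn⟩ := exists_floor_eq hv h
  have hvm : v = m + Int.fract v := by rw [← hm]; exact (Int.floor_add_fract v).symm
  have hf0 := Int.fract_nonneg v
  have hx1 : (m : ℝ) + N + 2 ≤ x := hn ▸ Int.floor_le x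
  have hx2 : x ≤ (m : ℝ) + N + 2 + 1 := hn ▸ (Int.lt_floor_add_one x).le
  have hx0 : 0 < x := by
    have : (0 : ℝ) ≤ m + N := by positivity
    linarith
  have key := millsApprox_le_one_add (n := m + N + 2) (f := Int.fract v) (by omega)
    (by push_cast; exact hx1) (by push_cast; exact hx2) hf0
  push_cast at key
  have tele := millsApprox_le_sum_add hx0 (show 0 ≤ v + 3 / 2 by linarith) N
  rw [besselH_eq_sum_add hv hx0 N]
  unfold besselLower
  rw [hm, hn]
  generalize Int.fract v = f at *
  have hT := exp_le_besselHTerm hv hx0 N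
  have hH := le_besselH (show 0 ≤ v + (N + 1) by positivity) hx0
  have hE : 0 < Real.exp ((v + 1 / 2) ^ 2 / (2 * x)) := Real.exp_pos _
  have hsum : Real.exp ((v + 1 / 2) ^ 2 / (2 * x)) *
      ∑ k ∈ Finset.range (N + 1), gaussExp x (v + 3 / 2 + k) ≤
      ∑ k ∈ Finset.range (N + 1), besselHTerm v x k := by
    rw [Finset.mul_sum]
    refine Finset.sum_le_sum fun k _ => le_trans (le_of_eq ?_) (exp_le_besselHTerm hv hx0 k)
    rw [gaussExp_shift]
    ring_nf
  have hlast : besselF (m + N + 2 + f) x * (1 + besselF (m + N + 2 + f + 1) x) ≤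
      besselH (v + (N + 1)) x := by
    refine le_trans (le_of_eq ?_) hH
    rw [hvm]
    ring_nf
  have hF : 0 ≤ besselF (m + N + 2 + f) x * (1 + besselF (m + N + 2 + f + 1) x) :=
    mul_nonneg (besselF_nonneg (by positivity) hx0.le)
      (add_nonneg zero_le_one (besselF_nonneg (by positivity) hx0.le))
  have h3 := mul_le_mul hT hlast hF (besselHTerm_pos hv hx0 N).le
  rw [Finset.sum_range_succ] at hsum
  rw [show v + 3 / 2 + N = m + N + 2 - 1 / 2 + f by rw [hvm]; ring] at tele hsum
  have h4 := mul_le_mul_of_nonneg_left (tele.trans (add_le_add_right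
    (mul_le_mul_of_nonneg_right key (gaussExp_pos x _).le) _)) hE.le
  -- the first two terms of the bound are the two approximate Gaussian tails
  have e1 : 2 * x * Real.exp (-(1 / x) * (v + 1)) / (v + 3 / 2 + √((v + 3 / 2) ^ 2 + 4 * x)) =
      Real.exp ((v + 1 / 2) ^ 2 / (2 * x)) *
        (millsApprox x (4 * x) (v + 3 / 2) * gaussExp x (v + 3 / 2)) := by
    rw [mul_left_comm, gaussExp_shift, millsApprox,
      show -(((v + 3 / 2) ^ 2 - (v + 1 / 2) ^ 2) / (2 * x)) = -(1 / x) * (v + 1) by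
        field_simp; ring]
    ring
  have e2 : 2 * x * Real.exp (-(1 / (2 * x)) * ((m : ℝ) + N + 2 - v - f + 1)
        * ((m : ℝ) + N + 2 + v - f + 2))
      / ((m : ℝ) + N + 2 + 3 / 2 + √(((m : ℝ) + N + 2 + 3 / 2) ^ 2 + 8 * x / Real.pi)) =
      Real.exp ((v + 1 / 2) ^ 2 / (2 * x)) *
        (millsApprox x (8 * x / Real.pi) (m + N + 2 + 3 / 2)
          * Real.exp (-((1 - f) * (2 * (m + N + 2) + 1) / x))
          * gaussExp x (m + N + 2 - 1 / 2 + f)) := by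
    rw [mul_left_comm, gaussExp_shift, millsApprox, mul_assoc (2 * x / _), ← Real.exp_add,
      show -((1 - f) * (2 * ((m : ℝ) + N + 2) + 1) / x)
        + -((((m : ℝ) + N + 2 - 1 / 2 + f) ^ 2 - (v + 1 / 2) ^ 2) / (2 * x)) =
        -(1 / (2 * x)) * ((m : ℝ) + N + 2 - v - f + 1) * ((m : ℝ) + N + 2 + v - f + 2) by
          field_simp; ring]
    ring
  have e3 : Real.exp (-(((m : ℝ) + N + 2 - m - 1) * ((m : ℝ) + N + 2 + v + f) / (2 * x))) =
      Real.exp (-((N + 1) * (2 * v + N + 2) / (2 * x))) := by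
    congr 3
    rw [hvm]; ring
  rw [e1, e2, e3, mul_assoc]
  linarith

/-! ### Bounds for the Gaussian tail -/

lemma continuous_gaussExp (y : ℝ) : Continuous (gaussExp y) := by
  unfold gaussExp; fun_prop

/-- The Gaussian tail `∫_t^∞ exp (-s²/(2y)) ds`, written as the half-line integral minus the
integral over `[0, t]`. -/
noncomputable def gaussTail (y t : ℝ) : ℝ :=
  √(Real.pi * y / 2) - ∫ s in (0 : ℝ)..t, gaussExp y s

lemma gaussTail_zero (y : ℝ) : gaussTail y 0 = √(Real.pi * y / 2) := by
  simp [gaussTail]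

lemma hasDerivAt_gaussTail (y t : ℝ) : HasDerivAt (gaussTail y) (-gaussExp y t) t :=
  (intervalIntegral.integral_hasDerivAt_right ((continuous_gaussExp y).intervalIntegrable _ _)
    ((continuous_gaussExp y).stronglyMeasurableAtFilter _ _)
    (continuous_gaussExp y).continuousAt).const_sub _

lemma integral_gaussExp_eq (y s t : ℝ) :
    ∫ r in s..t, gaussExp y r = gaussTail y s - gaussTail y t := by
  unfold gaussTail
  rw [← intervalIntegral.integral_add_adjacent_intervals
    ((continuous_gaussExp y).intervalIntegrable 0 s)
    ((continuous_gaussExp y).intervalIntegrable s t)]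
  ring

lemma tendsto_gaussTail {y : ℝ} (hy : 0 < y) : Tendsto (gaussTail y) atTop (𝓝 0) := by
  have e : gaussExp y = fun s => Real.exp (-(1 / (2 * y)) * s ^ 2) := by
    funext s; unfold gaussExp; congr 1; field_simp
  have hb : 0 < 1 / (2 * y) := by positivity
  have h := MeasureTheory.intervalIntegral_tendsto_integral_Ioi 0
    (integrable_exp_neg_mul_sq hb).integrableOn tendsto_id
  rw [integral_gaussian_Ioi] at h
  have h2 := h.const_sub (√(Real.pi * y / 2))
  have e2 : √(Real.pi * y / 2) - √(Real.pi / (1 / (2 * y))) / 2 = 0 := by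
    rw [show Real.pi / (1 / (2 * y)) = 2 ^ 2 * (Real.pi * y / 2) by field_simp,
      Real.sqrt_mul (by norm_num), Real.sqrt_sq (by norm_num)]
    ring
  rw [e2] at h2
  refine h2.congr fun t => ?_
  simp only [gaussTail, e, id]

lemma tendsto_gaussExp {y : ℝ} (hy : 0 < y) : Tendsto (gaussExp y) atTop (𝓝 0) := by
  unfold gaussExp
  refine Real.tendsto_exp_neg_atTop_nhds_zero.comp ?_
  exact (tendsto_pow_atTop two_ne_zero).atTop_div_const (by positivity)

lemma tendsto_millsApprox_mul_gaussExp {y κ : ℝ} (hy : 0 < y) (hκ : 0 < κ) :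
    Tendsto (fun t => millsApprox y κ t * gaussExp y t) atTop (𝓝 0) := by
  have h := (tendsto_gaussExp hy).const_mul (millsApprox y κ 0)
  rw [mul_zero] at h
  refine squeeze_zero' ?_ ?_ h
  · filter_upwards [eventually_ge_atTop 0] with t ht
    exact (mul_pos (millsApprox_pos hy hκ ht) (gaussExp_pos y t)).le
  · filter_upwards [eventually_ge_atTop 0] with t ht
    exact mul_le_mul_of_nonneg_right (millsApprox_anti hy hκ le_rfl ht) (gaussExp_pos y t).le

lemma hasDerivAt_millsApprox_sub_gaussTail {y κ t : ℝ} (hκ : 0 < κ) (ht : 0 ≤ t) :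
    HasDerivAt (fun s => millsApprox y κ s * gaussExp y s - gaussTail y s)
      ((1 - millsApprox y κ t * (1 / √(t ^ 2 + κ) + t / y)) * gaussExp y t) t :=
  ((hasDerivAt_millsApprox_mul_gaussExp hκ ht).sub (hasDerivAt_gaussTail y t)).congr_deriv
    (by ring)

lemma tendsto_millsApprox_sub_gaussTail {y κ : ℝ} (hy : 0 < y) (hκ : 0 < κ) :
    Tendsto (fun t => millsApprox y κ t * gaussExp y t - gaussTail y t) atTop (𝓝 0) := by
  simpa using (tendsto_millsApprox_mul_gaussExp hy hκ).sub (tendsto_gaussTail hy)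

/-- Birnbaum's lower bound for the Gaussian tail. -/
lemma millsApprox_mul_gaussExp_le_gaussTail {y t : ℝ} (hy : 0 < y) (ht : 0 ≤ t) :
    millsApprox y (4 * y) t * gaussExp y t ≤ gaussTail y t := by
  have hκ : 0 < 4 * y := by positivity
  have hmono : MonotoneOn (fun s => millsApprox y (4 * y) s * gaussExp y s - gaussTail y s)
      (Set.Ici t) := by
    refine monotoneOn_of_hasDerivWithinAt_nonneg (convex_Ici t)
      (fun s hs => (hasDerivAt_millsApprox_sub_gaussTail hκ
        (ht.trans hs)).continuousAt.continuousWithinAt)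
      (fun s hs => (hasDerivAt_millsApprox_sub_gaussTail hκ
        (ht.trans (interior_subset hs))).hasDerivWithinAt) fun s hs => ?_
    exact mul_nonneg (sub_nonneg.2 (millsApprox_mul_le_one hy (ht.trans (interior_subset hs))))
      (gaussExp_pos y s).le
  have h := ge_of_tendsto (tendsto_millsApprox_sub_gaussTail hy hκ)
    (b := millsApprox y (4 * y) t * gaussExp y t - gaussTail y t) ?_
  · linarith
  · filter_upwards [eventually_ge_atTop t] with s hs
    exact hmono (Set.mem_Ici.2 le_rfl) hs hs

lemma one_sub_millsApprox_mul {y κ t : ℝ} (hy : 0 < y) (hκ : 0 < κ) (ht : 0 ≤ t) :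
    1 - millsApprox y κ t * (1 / √(t ^ 2 + κ) + t / y) =
      (t ^ 2 + κ - 2 * y - t * √(t ^ 2 + κ)) / ((t + √(t ^ 2 + κ)) * √(t ^ 2 + κ)) := by
  have hs : √(t ^ 2 + κ) ^ 2 = t ^ 2 + κ := Real.sq_sqrt (by positivity)
  have hs0 : 0 < √(t ^ 2 + κ) := Real.sqrt_pos.2 (by positivity)
  unfold millsApprox
  field_simp
  linear_combination hs

/-- Pollak's upper bound for the Gaussian tail. The difference of the two sides vanishes at `0` and
at infinity, and it increases up to one point and decreases from there on: for `2y < κ < 4y` the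
sign of its derivative is that of `(κ - 2y)² - (4y - κ) t²`. -/
lemma gaussTail_le_millsApprox_mul_gaussExp {y t : ℝ} (hy : 0 < y) (ht : 0 ≤ t) :
    gaussTail y t ≤ millsApprox y (8 * y / Real.pi) t * gaussExp y t := by
  have hpi := Real.pi_pos
  set κ := 8 * y / Real.pi with hκdef
  have hκ : 0 < κ := by positivity
  have hκ2 : 2 * y < κ := by
    rw [hκdef, lt_div_iff₀ hpi]; nlinarith [Real.pi_lt_four]
  have hκ4 : κ < 4 * y := by
    rw [hκdef, div_lt_iff₀ hpi]; nlinarith [Real.pi_gt_three]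
  set D := fun s => millsApprox y κ s * gaussExp y s - gaussTail y s with hD
  have hd := fun (s : ℝ) (hs : 0 ≤ s) => hasDerivAt_millsApprox_sub_gaussTail (y := y) hκ hs
  have hsq : ∀ s : ℝ, (s ^ 2 + κ - 2 * y) ^ 2 - (s * √(s ^ 2 + κ)) ^ 2 =
      (κ - 2 * y) ^ 2 - (4 * y - κ) * s ^ 2 := fun s => by
    rw [mul_pow, Real.sq_sqrt (by positivity)]; ring
  set t₀ := (κ - 2 * y) / √(4 * y - κ) with ht₀
  have hr : 0 < √(4 * y - κ) := Real.sqrt_pos.2 (by linarith)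
  have hr2 : √(4 * y - κ) ^ 2 = 4 * y - κ := Real.sq_sqrt (by linarith)
  have ht₀0 : 0 ≤ t₀ := div_nonneg (by linarith) hr.le
  have ht₀2 : (4 * y - κ) * t₀ ^ 2 = (κ - 2 * y) ^ 2 := by
    rw [ht₀, div_pow, hr2]
    have : 4 * y - κ ≠ 0 := by linarith
    field_simp
  have hD0 : D 0 = 0 := by
    have e1 : √(Real.pi * y / 2) * √κ = 2 * y := by
      rw [← Real.sqrt_mul (by positivity), hκdef,
        show Real.pi * y / 2 * (8 * y / Real.pi) = (2 * y) ^ 2 by field_simp; ring,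
        Real.sqrt_sq (by positivity)]
    have : 0 < √κ := Real.sqrt_pos.2 hκ
    simp only [hD, gaussTail_zero, millsApprox, gaussExp]
    rw [← e1]
    simp
    field_simp
    simp
  suffices 0 ≤ D t by simp only [hD] at this; linarith
  rcases le_total t t₀ with h | h
  · have hmono : MonotoneOn D (Set.Icc 0 t₀) := by
      refine monotoneOn_of_hasDerivWithinAt_nonneg (convex_Icc 0 t₀)
        (fun s hs => (hd s hs.1).continuousAt.continuousWithinAt)
        (fun s hs => (hd s (interior_subset hs).1).hasDerivWithinAt) fun s hs => ?_
      obtain ⟨hs0, hs1⟩ := interior_subset hs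
      have h1 : s * √(s ^ 2 + κ) ≤ s ^ 2 + κ - 2 * y := by
        refine le_of_sq_le_sq ?_ (by nlinarith)
        nlinarith [hsq s, mul_le_mul_of_nonneg_left (pow_le_pow_left₀ hs0 hs1 2)
          (show 0 ≤ 4 * y - κ by linarith)]
      rw [one_sub_millsApprox_mul hy hκ hs0]
      exact mul_nonneg (div_nonneg (by linarith) (by positivity)) (gaussExp_pos y s).le
    rw [← hD0]
    exact hmono ⟨le_rfl, ht₀0⟩ ⟨ht, h⟩ ht
  · have hanti : AntitoneOn D (Set.Ici t₀) := by
      refine antitoneOn_of_hasDerivWithinAt_nonpos (convex_Ici t₀)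
        (fun s hs => (hd s (ht₀0.trans hs)).continuousAt.continuousWithinAt)
        (fun s hs => (hd s (ht₀0.trans (interior_subset hs))).hasDerivWithinAt) fun s hs => ?_
      have hs1 : t₀ ≤ s := interior_subset hs
      have hs0 := ht₀0.trans hs1
      have h1 : s ^ 2 + κ - 2 * y ≤ s * √(s ^ 2 + κ) := by
        refine le_of_sq_le_sq ?_ (by positivity)
        nlinarith [hsq s, mul_le_mul_of_nonneg_left (pow_le_pow_left₀ ht₀0 hs1 2)
          (show 0 ≤ 4 * y - κ by linarith)]
      rw [one_sub_millsApprox_mul hy hκ hs0]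
      exact mul_nonpos_of_nonpos_of_nonneg
        (div_nonpos_of_nonpos_of_nonneg (by linarith) (by positivity)) (gaussExp_pos y s).le
    refine le_of_tendsto (tendsto_millsApprox_sub_gaussTail hy hκ) ?_
    filter_upwards [eventually_ge_atTop t] with s hs
    exact hanti h (h.trans hs) hs

/-! ### The upper bound for `H` -/

lemma besselH_le_besselUpper {v x : ℝ} (hv : 0 ≤ v) (h : ⌊v⌋ + 2 ≤ ⌊x⌋) :
    besselH v x ≤ besselUpper v x := by
  obtain ⟨m, N, hm, hn⟩ := exists_floor_eq hv h
  have hvm : v = m + Int.fract v := by rw [← hm]; exact (Int.floor_add_fract v).symm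
  have hf0 := Int.fract_nonneg v
  have hf1 := Int.fract_lt_one v
  have hx1 : (m : ℝ) + N + 2 ≤ x := hn ▸ Int.floor_le x
  have hm0 : (0 : ℝ) ≤ m := Nat.cast_nonneg m
  have hN0 : (0 : ℝ) ≤ N := Nat.cast_nonneg N
  have hx0 : 0 < x := by linarith
  have hα := besselAlpha_pos
  have hy : 0 < x / besselAlpha := by positivity
  rw [besselH_eq_sum_add hv hx0 N]
  unfold besselUpper
  rw [hm, hn]
  generalize Int.fract v = f at *
  have hT := besselHTerm_le_exp hv hx0 N (by linarith)
  have hH := besselH_le (show 0 ≤ v + (N + 1) by positivity) hx0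
  set y := x / besselAlpha with hydef
  have hsum : ∑ k ∈ Finset.range (N + 1), besselHTerm v x k ≤
      Real.exp (v ^ 2 / (2 * y)) * (gaussTail y v - gaussTail y x) := by
    calc ∑ k ∈ Finset.range (N + 1), besselHTerm v x k
        ≤ ∑ k ∈ Finset.range (N + 1),
            Real.exp (v ^ 2 / (2 * y)) * gaussExp y (v + ((k + 1 : ℕ) : ℝ)) := by
          refine Finset.sum_le_sum fun k hk => ?_
          have hkN : (k : ℝ) ≤ N := by exact_mod_cast Nat.lt_succ_iff.1 (Finset.mem_range.1 hk)
          refine (besselHTerm_le_exp hv hx0 k (by linarith)).trans (le_of_eq ?_)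
          rw [gaussExp_shift, hydef]
          congr 1
          push_cast
          field_simp
          ring
      _ = Real.exp (v ^ 2 / (2 * y)) *
            ∑ k ∈ Finset.range (N + 1), gaussExp y (v + ((k + 1 : ℕ) : ℝ)) := by
          rw [Finset.mul_sum]
      _ ≤ Real.exp (v ^ 2 / (2 * y)) * ∫ s in v..v + ((N + 1 : ℕ) : ℝ), gaussExp y s := by
          refine mul_le_mul_of_nonneg_left ?_ (Real.exp_pos _).le
          refine AntitoneOn.sum_le_integral fun a ha b _ hab => ?_
          exact gaussExp_anti hy (hv.trans ha.1) hab
      _ ≤ Real.exp (v ^ 2 / (2 * y)) * ∫ s in v..x, gaussExp y s := by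
          refine mul_le_mul_of_nonneg_left ?_ (Real.exp_pos _).le
          have hle : v + ((N + 1 : ℕ) : ℝ) ≤ x := by push_cast; linarith
          rw [← intervalIntegral.integral_add_adjacent_intervals
            ((continuous_gaussExp y).intervalIntegrable v (v + ((N + 1 : ℕ) : ℝ)))
            ((continuous_gaussExp y).intervalIntegrable _ x)]
          exact le_add_of_nonneg_right
            (intervalIntegral.integral_nonneg hle fun s _ => (gaussExp_pos y s).le)
      _ = _ := by rw [integral_gaussExp_eq]
  have hmills : gaussTail y v - gaussTail y x ≤
      millsApprox y (8 * y / Real.pi) v * gaussExp y v - millsApprox y (4 * y) x * gaussExp y x :=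
    sub_le_sub (gaussTail_le_millsApprox_mul_gaussExp hy hv)
      (millsApprox_mul_gaussExp_le_gaussTail hy hx0.le)
  have e1 : 2 * x / besselAlpha
      * (1 / (v + √(v ^ 2 + 8 * x / (Real.pi * besselAlpha)))
        - Real.exp (-(besselAlpha / (2 * x)) * (x ^ 2 - v ^ 2))
          / (x + √(x ^ 2 + 4 * x / besselAlpha))) =
      Real.exp (v ^ 2 / (2 * y)) * (millsApprox y (8 * y / Real.pi) v * gaussExp y v
        - millsApprox y (4 * y) x * gaussExp y x) := by
    rw [mul_sub (Real.exp _), mul_left_comm (Real.exp _), gaussExp_shift,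
      mul_left_comm (Real.exp _), gaussExp_shift, sub_self, zero_div,
      neg_zero, Real.exp_zero, millsApprox, millsApprox,
      show -((x ^ 2 - v ^ 2) / (2 * y)) = -(besselAlpha / (2 * x)) * (x ^ 2 - v ^ 2) by
        rw [hydef]; field_simp,
      show 8 * x / (Real.pi * besselAlpha) = 8 * y / Real.pi by rw [hydef]; field_simp,
      show 4 * x / besselAlpha = 4 * y by rw [hydef]; ring,
      show 2 * x / besselAlpha = 2 * y by rw [hydef]; ring]
    ring
  have e2 : Real.exp (-(besselAlpha / (2 * x)) * ((m : ℝ) + N + 2 - m - 1)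
      * ((m : ℝ) + N + 2 + v + f - 1)) =
      Real.exp (-(besselAlpha / (2 * x) * ((N + 1) * (2 * v + N + 1)))) := by
    congr 1
    rw [hvm]; ring
  have e3 : besselF (m + N + 2 + f - 1 / 2) x / (1 - besselF (m + N + 2 + f + 1 / 2) x) =
      besselF (v + (N + 1) + 1 / 2) x / (1 - besselF (v + (N + 1) + 3 / 2) x) := by
    rw [hvm]; ring_nf
  rw [e1, e2, e3]
  refine add_le_add (hsum.trans (mul_le_mul_of_nonneg_left hmills (Real.exp_pos _).le))
    (mul_le_mul hT hH ?_ (Real.exp_pos _).le)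
  exact tsum_nonneg fun k => (besselHTerm_pos (by positivity) hx0 k).le

/-! ### Asymptotics of the bounds -/

lemma tendsto_div_add_sqrt_div_sqrt {a κ : ℝ} (hκ : 0 < κ) :
    Tendsto (fun x : ℝ => 2 * x / (a + √(a ^ 2 + κ * x)) / √x) atTop (𝓝 (2 / √κ)) := by
  have h1 : Tendsto (fun x : ℝ => a / √x) atTop (𝓝 0) :=
    tendsto_const_nhds.div_atTop Real.tendsto_sqrt_atTop
  have h2 : Tendsto (fun x : ℝ => a ^ 2 / x) atTop (𝓝 0) :=
    tendsto_const_nhds.div_atTop tendsto_id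
  have h3 := (tendsto_const_nhds (x := (2 : ℝ))).div (h1.add (h2.add_const κ).sqrt) (by
    simpa using (Real.sqrt_pos.2 hκ).ne')
  rw [zero_add, zero_add] at h3
  refine h3.congr' ?_
  filter_upwards [eventually_gt_atTop 0] with x hx
  have hs : 0 < √x := Real.sqrt_pos.2 hx
  have e : √(a ^ 2 + κ * x) = √(a ^ 2 / x + κ) * √x := by
    rw [← Real.sqrt_mul (by positivity)]
    congr 1
    field_simp
  rw [e, show a + √(a ^ 2 / x + κ) * √x = (a / √x + √(a ^ 2 / x + κ)) * √x by field_simp,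
    div_div, mul_assoc _ (√x), Real.mul_self_sqrt hx.le, mul_div_mul_right _ _ hx.ne']
  rfl

lemma tendsto_div_sqrt_of_le_exp {g : ℝ → ℝ} {C c d : ℝ} (hc : 0 < c)
    (h0 : ∀ᶠ x in atTop, 0 ≤ g x)
    (h : ∀ᶠ x in atTop, g x ≤ C * Real.exp (-(c * (x - d)))) :
    Tendsto (fun x => g x / √x) atTop (𝓝 0) := by
  have hexp : Tendsto (fun x : ℝ => C * Real.exp (-(c * (x - d)))) atTop (𝓝 0) := by
    rw [← mul_zero C]
    refine Tendsto.const_mul C (Real.tendsto_exp_neg_atTop_nhds_zero.comp ?_)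
    exact (tendsto_atTop_add_const_right _ (-d) tendsto_id).const_mul_atTop hc
  refine squeeze_zero' ?_ ?_ hexp
  · filter_upwards [h0] with x hx
    positivity
  · filter_upwards [h0, h, eventually_ge_atTop 1] with x hx hx' hx1
    exact (div_le_self hx (Real.one_le_sqrt.2 hx1)).trans hx'

lemma tendsto_besselLower_div_sqrt {v : ℝ} (hv : 0 ≤ v) :
    Tendsto (fun x : ℝ => besselLower v x / √x) atTop (𝓝 1) := by
  have hf0 := Int.fract_nonneg v
  have hf1 := Int.fract_lt_one v
  have hm := Int.floor_le v
  have hA : Tendsto (fun x : ℝ => 2 * x * Real.exp (-(1 / x) * (v + 1))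
      / (v + 3 / 2 + √((v + 3 / 2) ^ 2 + 4 * x)) / √x) atTop (𝓝 1) := by
    have h1 := tendsto_div_add_sqrt_div_sqrt (a := v + 3 / 2) (κ := 4) (by norm_num)
    have h2 : Tendsto (fun x : ℝ => Real.exp (-(1 / x) * (v + 1))) atTop (𝓝 1) := by
      have h3 : Tendsto (fun x : ℝ => -(1 / x) * (v + 1)) atTop (𝓝 (-0 * (v + 1))) :=
        ((tendsto_const_nhds.div_atTop tendsto_id).neg).mul_const _
      rw [neg_zero, zero_mul] at h3
      simpa [Function.comp_def] using (Real.continuous_exp.tendsto 0).comp h3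
    have h4 := h1.mul h2
    rw [show √(4 : ℝ) = 2 by
      rw [show (4 : ℝ) = 2 ^ 2 by norm_num, Real.sqrt_sq (by norm_num)], mul_one,
      div_self two_ne_zero] at h4
    exact h4.congr fun x => by ring
  have hB : Tendsto (fun x : ℝ => 2 * x * Real.exp (-(1 / (2 * x)) * ((⌊x⌋ : ℝ) - v - Int.fract v + 1)
        * ((⌊x⌋ : ℝ) + v - Int.fract v + 2))
      / ((⌊x⌋ : ℝ) + 3 / 2 + √(((⌊x⌋ : ℝ) + 3 / 2) ^ 2 + 8 * x / Real.pi)) / √x)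
      atTop (𝓝 0) := by
    refine tendsto_div_sqrt_of_le_exp (C := 2) (c := 1 / 2) (d := v + 1) (by norm_num) ?_ ?_
    · filter_upwards [eventually_ge_atTop 1] with x hx
      have hn := Int.lt_floor_add_one x
      have : 0 < (⌊x⌋ : ℝ) + 3 / 2 := by linarith
      positivity
    · filter_upwards [eventually_ge_atTop (v + 1)] with x hx
      have hx0 : 0 < x := by linarith
      have hn := Int.lt_floor_add_one x
      have h1 : x ≤ (⌊x⌋ : ℝ) + 3 / 2 + √(((⌊x⌋ : ℝ) + 3 / 2) ^ 2 + 8 * x / Real.pi) := by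
        have := Real.sqrt_nonneg (((⌊x⌋ : ℝ) + 3 / 2) ^ 2 + 8 * x / Real.pi)
        linarith
      have h2 : -(1 / (2 * x)) * ((⌊x⌋ : ℝ) - v - Int.fract v + 1)
          * ((⌊x⌋ : ℝ) + v - Int.fract v + 2) ≤ -(1 / 2 * (x - (v + 1))) := by
        have := mul_le_mul (show x - (v + 1) ≤ (⌊x⌋ : ℝ) - v - Int.fract v + 1 by linarith)
          (show x ≤ (⌊x⌋ : ℝ) + v - Int.fract v + 2 by linarith) hx0.le (by linarith)
        calc _ = -(1 / (2 * x)) * (((⌊x⌋ : ℝ) - v - Int.fract v + 1)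
              * ((⌊x⌋ : ℝ) + v - Int.fract v + 2)) := by ring
          _ ≤ -(1 / (2 * x)) * ((x - (v + 1)) * x) :=
              mul_le_mul_of_nonpos_left this (neg_nonpos.2 (by positivity))
          _ = _ := by field_simp
      rw [div_le_iff₀ (hx0.trans_le h1)]
      calc _ ≤ 2 * x * Real.exp (-(1 / 2 * (x - (v + 1)))) := by gcongr
        _ = 2 * Real.exp (-(1 / 2 * (x - (v + 1)))) * x := by ring
        _ ≤ _ := by gcongr
  have hC : Tendsto (fun x : ℝ =>
      Real.exp (-(((⌊x⌋ : ℝ) - (⌊v⌋ : ℝ) - 1) * ((⌊x⌋ : ℝ) + v + Int.fract v) / (2 * x)))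
        * besselF ((⌊x⌋ : ℝ) + Int.fract v) x
        * (1 + besselF ((⌊x⌋ : ℝ) + Int.fract v + 1) x) / √x) atTop (𝓝 0) := by
    refine tendsto_div_sqrt_of_le_exp (C := 2) (c := 1 / 4) (d := v + 2) (by norm_num) ?_ ?_
    · filter_upwards [eventually_ge_atTop 1] with x hx
      have hn := Int.lt_floor_add_one x
      have := besselF_nonneg (show 0 ≤ (⌊x⌋ : ℝ) + Int.fract v by linarith)
        (show 0 ≤ x by linarith)
      have := besselF_nonneg (show 0 ≤ (⌊x⌋ : ℝ) + Int.fract v + 1 by linarith)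
        (show 0 ≤ x by linarith)
      positivity
    · filter_upwards [eventually_ge_atTop (v + 2)] with x hx
      have hx0 : 0 < x := by linarith
      have hn := Int.lt_floor_add_one x
      have hF1 := besselF_le_one (show 0 ≤ (⌊x⌋ : ℝ) + Int.fract v by linarith) hx0
      have hF2 := besselF_le_one (show 0 ≤ (⌊x⌋ : ℝ) + Int.fract v + 1 by linarith) hx0
      have hF1' := besselF_nonneg (show 0 ≤ (⌊x⌋ : ℝ) + Int.fract v by linarith) hx0.le
      have hF2' := besselF_nonneg (show 0 ≤ (⌊x⌋ : ℝ) + Int.fract v + 1 by linarith) hx0.le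
      have h2 : 1 / 4 * (x - (v + 2)) ≤
          ((⌊x⌋ : ℝ) - (⌊v⌋ : ℝ) - 1) * ((⌊x⌋ : ℝ) + v + Int.fract v) / (2 * x) := by
        rw [le_div_iff₀ (by positivity)]
        have := mul_le_mul (show x - (v + 2) ≤ (⌊x⌋ : ℝ) - (⌊v⌋ : ℝ) - 1 by linarith)
          (show x / 2 ≤ (⌊x⌋ : ℝ) + v + Int.fract v by linarith) (by positivity) (by linarith)
        linarith
      calc _ ≤ Real.exp (-(1 / 4 * (x - (v + 2)))) * 1 * (1 + 1) := by gcongr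
        _ = _ := by ring
  have h := (hA.sub hB).add hC
  rw [sub_zero, add_zero] at h
  exact h.congr fun x => by unfold besselLower; ring

lemma tendsto_besselUpper_div_sqrt {v : ℝ} (hv : 0 ≤ v) :
    Tendsto (fun x : ℝ => besselUpper v x / √x) atTop
      (𝓝 (√(Real.pi / (2 * besselAlpha)))) := by
  have hf0 := Int.fract_nonneg v
  have hf1 := Int.fract_lt_one v
  have hm := Int.floor_le v
  have hα := besselAlpha_pos
  have hA : Tendsto (fun x : ℝ => 2 * x / besselAlpha
      * (1 / (v + √(v ^ 2 + 8 * x / (Real.pi * besselAlpha)))) / √x) atTop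
      (𝓝 (√(Real.pi / (2 * besselAlpha)))) := by
    have h1 := (tendsto_div_add_sqrt_div_sqrt (a := v) (κ := 8 / (Real.pi * besselAlpha))
      (by positivity)).const_mul (1 / besselAlpha)
    have e : 1 / besselAlpha * (2 / √(8 / (Real.pi * besselAlpha))) =
        √(Real.pi / (2 * besselAlpha)) := by
      have hs : 0 < √(8 / (Real.pi * besselAlpha)) := Real.sqrt_pos.2 (by positivity)
      rw [div_mul_div_comm, div_eq_iff (by positivity), mul_left_comm,
        ← Real.sqrt_mul (by positivity),
        show Real.pi / (2 * besselAlpha) * (8 / (Real.pi * besselAlpha)) = (2 / besselAlpha) ^ 2 by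
          field_simp; norm_num, Real.sqrt_sq (by positivity)]
      field_simp
    rw [e] at h1
    refine h1.congr fun x => ?_
    rw [show 8 / (Real.pi * besselAlpha) * x = 8 * x / (Real.pi * besselAlpha) by ring]
    ring
  have hB : Tendsto (fun x : ℝ => 2 * x / besselAlpha *
      (Real.exp (-(besselAlpha / (2 * x)) * (x ^ 2 - v ^ 2))
        / (x + √(x ^ 2 + 4 * x / besselAlpha))) / √x) atTop (𝓝 0) := by
    refine tendsto_div_sqrt_of_le_exp (C := 2 / besselAlpha) (c := besselAlpha / 2) (d := v)
      (by positivity) ?_ ?_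
    · filter_upwards [eventually_ge_atTop 0] with x hx
      positivity
    · filter_upwards [eventually_ge_atTop (v + 1)] with x hx
      have hx0 : 0 < x := by linarith
      have h1 : x ≤ x + √(x ^ 2 + 4 * x / besselAlpha) :=
        le_add_of_nonneg_right (Real.sqrt_nonneg _)
      have h2 : -(besselAlpha / (2 * x)) * (x ^ 2 - v ^ 2) ≤ -(besselAlpha / 2 * (x - v)) := by
        have : (x - v) * x ≤ x ^ 2 - v ^ 2 := by nlinarith
        calc _ ≤ -(besselAlpha / (2 * x)) * ((x - v) * x) :=
              mul_le_mul_of_nonpos_left this (neg_nonpos.2 (by positivity))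
          _ = _ := by field_simp
      calc _ ≤ 2 * x / besselAlpha * (Real.exp (-(besselAlpha / 2 * (x - v))) / x) := by gcongr
        _ = _ := by field_simp
  have hC : Tendsto (fun x : ℝ =>
      Real.exp (-(besselAlpha / (2 * x)) * ((⌊x⌋ : ℝ) - (⌊v⌋ : ℝ) - 1)
          * ((⌊x⌋ : ℝ) + v + Int.fract v - 1))
        * (besselF ((⌊x⌋ : ℝ) + Int.fract v - 1 / 2) x
          / (1 - besselF ((⌊x⌋ : ℝ) + Int.fract v + 1 / 2) x)) / √x) atTop (𝓝 0) := by
    refine tendsto_div_sqrt_of_le_exp (C := 3) (c := besselAlpha / 4) (d := v + 2)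
      (by positivity) ?_ ?_
    · filter_upwards [eventually_ge_atTop 2] with x hx
      have hn := Int.lt_floor_add_one x
      have h1 := besselF_nonneg (show 0 ≤ (⌊x⌋ : ℝ) + Int.fract v - 1 / 2 by linarith)
        (show 0 ≤ x by linarith)
      have h2 := besselF_lt_one (show 0 < (⌊x⌋ : ℝ) + Int.fract v + 1 / 2 by linarith)
        (show 0 < x by linarith)
      have := sub_pos.2 h2
      positivity
    · filter_upwards [eventually_ge_atTop (v + 4)] with x hx
      have hx0 : 0 < x := by linarith
      have hn := Int.lt_floor_add_one x
      have hF1 := besselF_le_one (show 0 ≤ (⌊x⌋ : ℝ) + Int.fract v - 1 / 2 by linarith) hx0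
      have hF2 : besselF ((⌊x⌋ : ℝ) + Int.fract v + 1 / 2) x ≤ 2 / 3 :=
        besselF_le (by linarith) hx0 (by norm_num) (by linarith)
      have h2 : -(besselAlpha / (2 * x)) * ((⌊x⌋ : ℝ) - (⌊v⌋ : ℝ) - 1)
          * ((⌊x⌋ : ℝ) + v + Int.fract v - 1) ≤ -(besselAlpha / 4 * (x - (v + 2))) := by
        have := mul_le_mul (show x - (v + 2) ≤ (⌊x⌋ : ℝ) - (⌊v⌋ : ℝ) - 1 by linarith)
          (show x / 2 ≤ (⌊x⌋ : ℝ) + v + Int.fract v - 1 by linarith) (by positivity) (by linarith)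
        calc _ = -(besselAlpha / (2 * x)) * (((⌊x⌋ : ℝ) - (⌊v⌋ : ℝ) - 1)
              * ((⌊x⌋ : ℝ) + v + Int.fract v - 1)) := by ring
          _ ≤ -(besselAlpha / (2 * x)) * ((x - (v + 2)) * (x / 2)) :=
              mul_le_mul_of_nonpos_left this (neg_nonpos.2 (by positivity))
          _ = _ := by field_simp; ring
      have h3 : besselF ((⌊x⌋ : ℝ) + Int.fract v - 1 / 2) x
          / (1 - besselF ((⌊x⌋ : ℝ) + Int.fract v + 1 / 2) x) ≤ 3 := by
        rw [div_le_iff₀ (by linarith)]; linarith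
      calc _ ≤ Real.exp (-(besselAlpha / 4 * (x - (v + 2)))) * 3 :=
            mul_le_mul (Real.exp_le_exp.2 h2) h3
              (div_nonneg (besselF_nonneg (by linarith) hx0.le) (by linarith)) (Real.exp_pos _).le
        _ = _ := by ring
  have h := (hA.sub hB).add hC
  rw [sub_zero, add_zero] at h
  exact h.congr fun x => by unfold besselUpper; ring

theorem theorem1 :
    (∀ ν x : ℝ, 0 ≤ ν → 0 ≤ x →
      Summable (besselHTerm ν x) ∧
      besselF (ν + 1) x * (1 + besselF (ν + 2) x) ≤ besselH ν x ∧
      besselH ν x ≤ besselF (ν + 1 / 2) x / (1 - besselF (ν + 3 / 2) x)) ∧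
    (∀ ν x : ℝ, 0 ≤ ν → 0 ≤ x → ⌊ν⌋ + 2 ≤ ⌊x⌋ →
      besselLower ν x ≤ besselH ν x ∧ besselH ν x ≤ besselUpper ν x) ∧
    (∀ ν : ℝ, 0 ≤ ν →
      Tendsto (fun x : ℝ => besselLower ν x / √x) atTop (𝓝 1) ∧
      Tendsto (fun x : ℝ => besselUpper ν x / √x) atTop
        (𝓝 (√(Real.pi / (2 * besselAlpha))))) :=
  ⟨fun _ _ hν hx => besselH_bounds hν hx,
    fun _ _ hν _ h => ⟨besselLower_le_besselH hν h, besselH_le_besselUpper hν h⟩,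
    fun _ hν => ⟨tendsto_besselLower_div_sqrt hν, tendsto_besselUpper_div_sqrt hν⟩⟩
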